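/- Let $q,r\ge 2$ be integers. Let $\mathbb T_q$ and $\mathbb T_r$ be the homogeneous trees of degrees $q+1$ and $r+1$, with roots $o_1,o_2$ and reference ends $\omega_1,\omega_2$. On each of them (root $o_i$, end $\omega_i$) let $\mathfrak h$ be the Busemann function $\mathfrak h(x)=d(x,c)-d(o_i,c)$, where $c$ is the first common vertex of the geodesic rays from $x$ and from $o_i$ to $\omega_i$. The Diestel–Leader graph $\mathrm{DL}(q,r)$ has vertex set $\{x_1x_2\in\mathbb T_q\times\mathbb T_r:\mathfrak h(x_1)+\mathfrak h(x_2)=0\}$, with $x_1x_2\sim y_1y_2$ if and only if $x_1\sim y_1$ and $x_2\sim y_2$; put $o=o_1o_2$. Let $p^{(N)}(x,y)$ be the $N$-step transition probabilities of simple random walk (SRW) on $\mathrm{DL}(q,r)$, let $P$ be its transition operator on $\ell^2(\mathrm{DL}(q,r))$, and let $\rho(P)$ be the spectral radius of $P$. Put $$\xi_1=\Bigl(\frac{2\pi^2}{\log q}\Bigr)^{1/3},\qquad B_1=3\Bigl(\frac{\pi\log q}{2}\Bigr)^{2/3},\qquad C_1=6\Bigl(\frac{(\log q)^2}{4\pi}\Bigr)^{2/3}.$$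 Below, $\sim$ between sequences means that their quotient tends to $1$. **Theorem 5.2.** (i) If $r>q$, then $P$ is bounded with $\rho(P)=\dfrac{2\sqrt{qr}}{q+r}$, and as $N\to\infty$ $$p^{(2N)}(o,o)\sim A_1\,\rho(P)^{2N}\exp\bigl(-B_1N^{1/3}\bigr)\,N^{-5/6},\qquad A_1=4\pi^2\,\xi_1^{-3}\Bigl(\frac{2\pi}{C_1}\Bigr)^{1/2}\frac{qr(q+r)(q-1)(r-1)}{(r-q)^3}.$$ (ii) If $r=q$, then as $N\to\infty$ $$p^{(2N)}(o,o)\sim \bar A_1\exp\bigl(-B_1N^{1/3}\bigr)\,N^{1/6},\qquad \bar A_1=2(q-1)^2\Bigl(\frac{2\pi}{C_1}\Bigr)^{1/2}.$$ -/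

import Mathlib

namespace DiestelLeader

/-- A geodesic ray in a graph: a one-sided infinite sequence of vertices `x 0, x 1, …` with
`d (x i) (x j) = |i - j|`. Such a ray represents an end of a tree, and every end of a tree is
represented by such a ray. -/
def IsGeodesicRay {V : Type*} (T : SimpleGraph V) (x : ℕ → V) : Prop :=
  ∀ i j : ℕ, (T.dist (x i) (x j) : ℤ) = |(i : ℤ) - (j : ℤ)|

/-- The Busemann function of the tree `T` with root `o`, with respect to the end represented by the
ray `ω`: `h(x) = lim_n (d(x, ω n) - d(o, ω n))`. In a tree the sequence is eventually constant:
if `c` is the point where the rays from `x` and from `o` to the end meet, its eventual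
value is `d(x, c) - d(o, c)`. -/
noncomputable def busemann {V : Type*} (T : SimpleGraph V) (ω : ℕ → V) (o x : V) : ℤ :=
  Filter.limUnder Filter.atTop fun n : ℕ => (T.dist x (ω n) : ℤ) - (T.dist o (ω n) : ℤ)

theorem busemann_root {V : Type*} (T : SimpleGraph V) (ω : ℕ → V) (o : V) :
    busemann T ω o o = 0 := by
  simp only [busemann, sub_self]
  exact Filter.Tendsto.limUnder_eq tendsto_const_nhds

/-- The vertex set `{x₁x₂ : h(x₁) + h(x₂) = 0}` of the horocyclic product of two rooted trees
with reference ends. -/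
abbrev DLVertex {V₁ V₂ : Type*} (T₁ : SimpleGraph V₁) (T₂ : SimpleGraph V₂)
    (ω₁ : ℕ → V₁) (ω₂ : ℕ → V₂) (o₁ : V₁) (o₂ : V₂) : Type _ :=
  {x : V₁ × V₂ // busemann T₁ ω₁ o₁ x.1 + busemann T₂ ω₂ o₂ x.2 = 0}

/-- The horocyclic product: `x₁x₂ ∼ y₁y₂` iff `x₁ ∼ y₁` and `x₂ ∼ y₂`. For homogeneous trees of
degrees `q + 1` and `r + 1` this is the Diestel-Leader graph `DL(q, r)`. -/
def DLGraph {V₁ V₂ : Type*} (T₁ : SimpleGraph V₁) (T₂ : SimpleGraph V₂)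
    (ω₁ : ℕ → V₁) (ω₂ : ℕ → V₂) (o₁ : V₁) (o₂ : V₂) :
    SimpleGraph (DLVertex T₁ T₂ ω₁ ω₂ o₁ o₂) where
  Adj x y := T₁.Adj x.1.1 y.1.1 ∧ T₂.Adj x.1.2 y.1.2
  symm := ⟨fun _ _ h => ⟨h.1.symm, h.2.symm⟩⟩
  loopless := ⟨fun _ h => h.1.ne rfl⟩

/-- The reference vertex `o = o₁o₂` of the horocyclic product. -/
def DLRoot {V₁ V₂ : Type*} (T₁ : SimpleGraph V₁) (T₂ : SimpleGraph V₂)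
    (ω₁ : ℕ → V₁) (ω₂ : ℕ → V₂) (o₁ : V₁) (o₂ : V₂) : DLVertex T₁ T₂ ω₁ ω₂ o₁ o₂ :=
  ⟨(o₁, o₂), by simp [busemann_root]⟩

open Classical in
/-- Transition probabilities of simple random walk on a locally finite graph:
`p(x, y) = 1 / deg x` if `x ∼ y`, and `0` otherwise. -/
noncomputable def srwStep {X : Type*} (G : SimpleGraph X) (x y : X) : ℝ :=
  if G.Adj x y then 1 / ((G.neighborSet x).ncard : ℝ) else 0

open Classical in
/-- The `N`-step transition probabilities `p^(N)(x, y)` of simple random walk (for a locally finite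
graph all the sums have finitely many nonzero terms). -/
noncomputable def srwProb {X : Type*} (G : SimpleGraph X) : ℕ → X → X → ℝ
  | 0, x, y => if x = y then 1 else 0
  | N + 1, x, y => ∑' z : X, srwStep G x z * srwProb G N z y

/-- `P` is the transition operator of simple random walk acting on `ℓ²(X)`:
`P f (x) = ∑_y p(x, y) f(y)`. -/
def IsSRWOperator {X : Type*} (G : SimpleGraph X)
    (P : lp (fun _ : X => ℂ) 2 →L[ℂ] lp (fun _ : X => ℂ) 2) : Prop :=
  ∀ (f : lp (fun _ : X => ℂ) 2) (x : X), (P f) x = ∑' y : X, (srwStep G x y : ℂ) * f y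

/-- `ξ₁ = (2 π² / log q)^(1/3)`. -/
noncomputable def xi₁ (q : ℕ) : ℝ := (2 * Real.pi ^ 2 / Real.log q) ^ ((1 : ℝ) / 3)

/-- `B₁ = 3 (π log q / 2)^(2/3)`. -/
noncomputable def B₁ (q : ℕ) : ℝ := 3 * (Real.pi * Real.log q / 2) ^ ((2 : ℝ) / 3)

/-- `C₁ = 6 ((log q)² / (4 π))^(2/3)`. -/
noncomputable def C₁ (q : ℕ) : ℝ := 6 * (Real.log q ^ 2 / (4 * Real.pi)) ^ ((2 : ℝ) / 3)

/-- `A₁ = 4 π² ξ₁⁻³ (2π / C₁)^(1/2) q r (q + r) (q - 1) (r - 1) / (r - q)³`, for `r > q`. -/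
noncomputable def A₁ (q r : ℕ) : ℝ :=
  4 * Real.pi ^ 2 * (xi₁ q ^ 3)⁻¹ * √(2 * Real.pi / C₁ q) *
    ((q : ℝ) * r * (q + r) * (q - 1) * (r - 1)) / ((r : ℝ) - q) ^ 3

/-- `Ā₁ = 2 (q - 1)² (2π / C₁)^(1/2)`, for `r = q`. -/
noncomputable def Abar₁ (q : ℕ) : ℝ := 2 * ((q : ℝ) - 1) ^ 2 * √(2 * Real.pi / C₁ q)

end DiestelLeader

namespace DiestelLeader

section Tree

variable {V : Type*} {T : SimpleGraph V}

/-- A graph with a height function `h` whose vertices have exactly one neighbour `par x` at height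
`h x - 1`, while all other neighbours are the `q` elements of `ch x`, at height `h x + 1`. -/
structure IsHoro (T : SimpleGraph V) (h : V → ℤ) (par : V → V) (ch : V → Finset V) (q : ℕ) :
    Prop where
  h_par : ∀ x, h (par x) = h x - 1
  adj_iff : ∀ x y, T.Adj x y ↔ par x = y ∨ par y = x
  mem_ch : ∀ x y, y ∈ ch x ↔ par y = x
  card_ch : ∀ x, (ch x).card = q

theorem eventually_const_of_antitone_of_bddBelow (a : ℕ → ℤ) (ha : Antitone a) (B : ℤ)
    (hB : ∀ n, B ≤ a n) : ∃ c, ∀ᶠ n in Filter.atTop, a n = c := by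
  obtain ⟨c, hc, hmin⟩ := Int.exists_least_of_bdd (P := fun z => ∃ n, a n = z)
    ⟨B, by rintro z ⟨n, rfl⟩; exact hB n⟩ ⟨a 0, 0, rfl⟩
  obtain ⟨n, hn⟩ := hc
  refine ⟨c, Filter.eventually_atTop.2 ⟨n, fun m hm => le_antisymm ?_ (hmin _ ⟨m, rfl⟩)⟩⟩
  exact hn ▸ ha hm

theorem IsGeodesicRay.dist_succ_le (hT : T.IsTree) {ω : ℕ → V} (hω : IsGeodesicRay T ω) (x : V)
    (n : ℕ) : T.dist x (ω (n + 1)) ≤ T.dist x (ω n) + 1 := by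
  have h1 := hT.connected.dist_triangle (u := x) (v := ω n) (w := ω (n + 1))
  have h2 := hω n (n + 1)
  have : |(n : ℤ) - ((n + 1 : ℕ) : ℤ)| = 1 := by push_cast; simp
  omega

theorem IsGeodesicRay.eventually_dist_sub (hT : T.IsTree) {ω : ℕ → V} (hω : IsGeodesicRay T ω)
    (x : V) : ∃ c : ℤ, ∀ᶠ n : ℕ in Filter.atTop, (T.dist x (ω n) : ℤ) - n = c := by
  refine eventually_const_of_antitone_of_bddBelow (fun n : ℕ => (T.dist x (ω n) : ℤ) - n)
    (antitone_nat_of_succ_le fun n => ?_) (-(T.dist x (ω 0) : ℤ)) fun n => ?_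
  · have := hω.dist_succ_le hT x n
    push_cast
    omega
  · have h1 := hT.connected.dist_triangle (u := ω 0) (v := x) (w := ω n)
    have h2 := hω 0 n
    have h3 : |((0 : ℕ) : ℤ) - (n : ℤ)| = n := by simp
    rw [T.dist_comm (u := ω 0) (v := x)] at h1
    omega

theorem eventually_busemann (hT : T.IsTree) {ω : ℕ → V} (hω : IsGeodesicRay T ω) (o x : V) :
    ∀ᶠ n : ℕ in Filter.atTop, (T.dist x (ω n) : ℤ) - (T.dist o (ω n) : ℤ) = busemann T ω o x := by
  obtain ⟨c, hc⟩ := hω.eventually_dist_sub hT x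
  obtain ⟨d, hd⟩ := hω.eventually_dist_sub hT o
  have key : ∀ᶠ n : ℕ in Filter.atTop,
      (T.dist x (ω n) : ℤ) - (T.dist o (ω n) : ℤ) = c - d := by
    filter_upwards [hc, hd] with n h1 h2
    omega
  have : busemann T ω o x = c - d := by
    refine Filter.Tendsto.limUnder_eq ?_
    exact tendsto_const_nhds.congr' (key.mono fun n hn => hn.symm)
  simpa [this] using key

theorem eq_of_adj_of_dist_lt (hT : T.IsTree) {x y y' z : V} (hy : T.Adj x y) (hy' : T.Adj x y')
    (h : T.dist y z + 1 = T.dist x z) (h' : T.dist y' z + 1 = T.dist x z) : y = y' := by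
  obtain ⟨p, hp, hpl⟩ := hT.connected.exists_path_of_dist y z
  obtain ⟨p', hp', hpl'⟩ := hT.connected.exists_path_of_dist y' z
  have h1 : (SimpleGraph.Walk.cons hy p).IsPath :=
    SimpleGraph.Walk.isPath_of_length_eq_dist _ (by simp [hpl, h])
  have h2 : (SimpleGraph.Walk.cons hy' p').IsPath :=
    SimpleGraph.Walk.isPath_of_length_eq_dist _ (by simp [hpl', h'])
  have := (hT.isAcyclic.subsingleton_path x z).elim ⟨_, h1⟩ ⟨_, h2⟩
  have := congrArg (fun w : T.Path x z => w.1.snd) this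
  simpa using this

theorem exists_adj_dist_lt (hT : T.IsTree) {x z : V} (hxz : x ≠ z) :
    ∃ y, T.Adj x y ∧ T.dist y z + 1 = T.dist x z := by
  obtain ⟨p, hp, hpl⟩ := hT.connected.exists_path_of_dist x z
  cases p with
  | nil => exact absurd rfl hxz
  | @cons _ y _ hxy p =>
    refine ⟨y, hxy, ?_⟩
    have h1 := SimpleGraph.dist_le p
    simp only [SimpleGraph.Walk.length_cons] at hpl
    have := hT.dist_eq_dist_add_one_of_adj z hxy
    rw [T.dist_comm (u := z), T.dist_comm (u := z)] at this
    omega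

theorem busemann_adj (hT : T.IsTree) {ω : ℕ → V} (hω : IsGeodesicRay T ω) (o : V) {x y : V}
    (hxy : T.Adj x y) : busemann T ω o y = busemann T ω o x - 1 ∨
      busemann T ω o x = busemann T ω o y - 1 := by
  obtain ⟨n, h1, h2⟩ := ((eventually_busemann hT hω o x).and (eventually_busemann hT hω o y)).exists
  have := hT.dist_eq_dist_add_one_of_adj (ω n) hxy
  rw [T.dist_comm (u := ω n), T.dist_comm (u := ω n)] at this
  omega

theorem existsUnique_parent (hT : T.IsTree) {ω : ℕ → V} (hω : IsGeodesicRay T ω) (o x : V) :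
    ∃! y, T.Adj x y ∧ busemann T ω o y = busemann T ω o x - 1 := by
  refine existsUnique_of_exists_of_unique ?_ ?_
  · obtain ⟨c, hc⟩ := hω.eventually_dist_sub hT x
    obtain ⟨n, ⟨hn, hcn⟩, hge⟩ :=
      (((Filter.eventually_forall_ge_atTop.2 hc).and hc).and
        (Filter.eventually_ge_atTop ((-c).toNat + 1))).exists
    have hne : x ≠ ω n := by
      rintro h
      rw [← h, T.dist_self] at hcn
      omega
    obtain ⟨y, hxy, hy⟩ := exists_adj_dist_lt hT hne
    refine ⟨y, hxy, ?_⟩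
    have hmono : ∀ m ≥ n, (T.dist y (ω m) : ℤ) - m ≤ (T.dist y (ω n) : ℤ) - n := by
      intro m hm
      induction m, hm using Nat.le_induction with
      | base => exact le_rfl
      | succ m hm ih =>
        have := hω.dist_succ_le hT y m
        push_cast
        omega
    obtain ⟨m, ⟨h1, h2⟩, hm⟩ := (((eventually_busemann hT hω o x).and
      (eventually_busemann hT hω o y)).and (Filter.eventually_ge_atTop n)).exists
    have h3 := hmono m hm
    have h4 := hn m hm
    rcases busemann_adj hT hω o hxy with h | h <;> omega
  · rintro y y' ⟨hy, hhy⟩ ⟨hy', hhy'⟩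
    obtain ⟨n, ⟨h1, h2⟩, h3⟩ := (((eventually_busemann hT hω o x).and
      (eventually_busemann hT hω o y)).and (eventually_busemann hT hω o y')).exists
    exact eq_of_adj_of_dist_lt hT hy hy' (z := ω n) (by omega) (by omega)

theorem exists_isHoro [T.LocallyFinite] (hT : T.IsTree) {q : ℕ}
    (hdeg : T.IsRegularOfDegree (q + 1)) {ω : ℕ → V} (hω : IsGeodesicRay T ω) (o : V) :
    ∃ par ch, IsHoro T (busemann T ω o) par ch q := by
  classical
  choose par hpar huniq using existsUnique_parent hT hω o
  have hadj : ∀ x y, T.Adj x y ↔ par x = y ∨ par y = x := by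
    intro x y
    constructor
    · intro h
      rcases busemann_adj hT hω o h with h' | h'
      · exact Or.inl (huniq x y ⟨h, h'⟩).symm
      · exact Or.inr (huniq y x ⟨h.symm, h'⟩).symm
    · rintro (rfl | rfl)
      · exact (hpar x).1
      · exact (hpar y).1.symm
  have hne : ∀ x y, par y = x → y ≠ par x := by
    rintro x y rfl h
    have h1 := (hpar (par y)).2
    have h2 := (hpar y).2
    rw [← h] at h1
    omega
  refine ⟨par, fun x => (T.neighborFinset x).erase (par x), fun x => (hpar x).2, hadj, ?_, ?_⟩
  · intro x y
    rw [Finset.mem_erase, SimpleGraph.mem_neighborFinset, hadj]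
    constructor
    · rintro ⟨h1, h2 | h2⟩
      · exact absurd h2.symm h1
      · exact h2
    · intro h
      exact ⟨hne x y h, Or.inr h⟩
  · intro x
    rw [Finset.card_erase_of_mem (by simpa using (hpar x).1), SimpleGraph.card_neighborFinset_eq_degree,
      hdeg x, Nat.add_sub_cancel]

namespace IsHoro

variable {h : V → ℤ} {par : V → V} {ch : V → Finset V} {q : ℕ}

theorem h_iterate (H : IsHoro T h par ch q) (n : ℕ) (x : V) : h (par^[n] x) = h x - n := by
  induction n generalizing x with
  | zero => simp
  | succ n ih => rw [Function.iterate_succ_apply, ih, H.h_par]; push_cast; ring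

end IsHoro

open Classical in
/-- The function `q ^ (-a)` on the descendants of the `a`-th ancestor of `o`. -/
noncomputable def coneFun (par : V → V) (q : ℕ) (o : V) (a : ℕ) (x : V) : ℝ :=
  if ∃ n : ℕ, par^[n] x = par^[a] o then ((q : ℝ)⁻¹) ^ a else 0

/-- The difference of two consecutive functions `coneFun`. -/
noncomputable def coneDiff (par : V → V) (q : ℕ) (o : V) (a : ℕ) (x : V) : ℝ :=
  coneFun par q o a x - coneFun par q o (a + 1) x

namespace IsHoro

variable {h : V → ℤ} {par : V → V} {ch : V → Finset V} {q : ℕ} {o : V}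

theorem coneFun_child (H : IsHoro T h par ch q) (ho : h o = 0) {a : ℕ} {y : V}
    (hx : -(a : ℤ) ≤ h (par y)) : coneFun par q o a y = coneFun par q o a (par y) := by
  have : (∃ n : ℕ, par^[n] y = par^[a] o) ↔ ∃ n : ℕ, par^[n] (par y) = par^[a] o := by
    constructor
    · rintro ⟨n, hn⟩
      cases n with
      | zero =>
        have h1 := H.h_iterate a o
        rw [← hn, Function.iterate_zero_apply] at h1
        rw [H.h_par] at hx
        omega
      | succ n => exact ⟨n, by rwa [Function.iterate_succ_apply] at hn⟩
    · rintro ⟨n, hn⟩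
      exact ⟨n + 1, by rwa [Function.iterate_succ_apply]⟩
  classical
  unfold coneFun
  exact if_congr this rfl rfl

theorem coneDiff_child (H : IsHoro T h par ch q) (ho : h o = 0) {a : ℕ} {y : V}
    (hx : -(a : ℤ) ≤ h (par y)) : coneDiff par q o a y = coneDiff par q o a (par y) := by
  rw [coneDiff, coneDiff, H.coneFun_child ho hx,
    H.coneFun_child (a := a + 1) ho (by push_cast; omega)]

theorem coneFun_of_h_eq (H : IsHoro T h par ch q) (ho : h o = 0) [DecidableEq V] {a : ℕ} {x : V}
    (hx : h x = -(a : ℤ)) : coneFun par q o a x = if x = par^[a] o then ((q : ℝ)⁻¹) ^ a else 0 := by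
  have : (∃ n : ℕ, par^[n] x = par^[a] o) ↔ x = par^[a] o := by
    constructor
    · rintro ⟨n, hn⟩
      have h1 := congrArg h hn
      rw [H.h_iterate, H.h_iterate] at h1
      have : n = 0 := by omega
      simpa [this] using hn
    · intro hn
      exact ⟨0, hn⟩
  classical
  unfold coneFun
  exact if_congr this rfl rfl

theorem sum_coneDiff_child (H : IsHoro T h par ch q) (ho : h o = 0) {a : ℕ} {x : V}
    (hx : -(a : ℤ) ≤ h x) : ∑ y ∈ ch x, coneDiff par q o a y = q * coneDiff par q o a x := by
  rw [Finset.sum_congr rfl (g := fun _ => coneDiff par q o a x), Finset.sum_const, H.card_ch,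
    nsmul_eq_mul]
  intro y hy
  obtain rfl := (H.mem_ch x y).1 hy
  exact H.coneDiff_child ho hx

theorem sum_coneDiff_child_eq_zero (H : IsHoro T h par ch q) (hq : q ≠ 0) (ho : h o = 0) {a : ℕ}
    {x : V} (hx : h x = -(a : ℤ) - 1) : ∑ y ∈ ch x, coneDiff par q o a y = 0 := by
  classical
  have h1 : ∀ y ∈ ch x, coneDiff par q o a y =
      (if y = par^[a] o then ((q : ℝ)⁻¹) ^ a else 0) - coneFun par q o (a + 1) x := by
    intro y hy
    obtain rfl := (H.mem_ch x y).1 hy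
    have := H.h_par y
    rw [coneDiff, H.coneFun_of_h_eq ho (by omega), H.coneFun_child ho (a := a + 1)]
    push_cast
    omega
  rw [Finset.sum_congr rfl h1, Finset.sum_sub_distrib, Finset.sum_ite_eq', Finset.sum_const,
    H.card_ch, nsmul_eq_mul, H.coneFun_of_h_eq ho (a := a + 1) (by push_cast; omega),
    Function.iterate_succ_apply']
  simp only [H.mem_ch]
  by_cases hxo : par (par^[a] o) = x
  · have : (q : ℝ) ≠ 0 := by exact_mod_cast hq
    simp [hxo]
    field_simp
    ring
  · simp [hxo, Ne.symm hxo]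

theorem summable_coneFun (par : V → V) (hq : 2 ≤ q) (o x : V) :
    Summable fun a => coneFun par q o a x := by
  have hq' : (2 : ℝ) ≤ q := by exact_mod_cast hq
  refine Summable.of_nonneg_of_le (fun a => ?_) (fun a => ?_)
    (summable_geometric_of_lt_one (r := (q : ℝ)⁻¹) (by positivity)
      (inv_lt_one_of_one_lt₀ (by linarith)))
  · unfold coneFun; split_ifs <;> positivity
  · unfold coneFun; split_ifs
    · exact le_rfl
    · positivity

theorem hasSum_coneDiff (H : IsHoro T h par ch q) (hq : 2 ≤ q) (ho : h o = 0) [DecidableEq V]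
    {x : V} (hx : h x = 0) : HasSum (fun a => coneDiff par q o a x) (if x = o then 1 else 0) := by
  have hs := (summable_coneFun par hq o x)
  have h1 := hs.hasSum
  have h2 := ((summable_nat_add_iff 1).2 hs).hasSum
  have h3 := h1.sub h2
  have h4 := hs.sum_add_tsum_nat_add 1
  have h5 := H.coneFun_of_h_eq ho (a := 0) (x := x) (by simpa using hx)
  simp only [Function.iterate_zero_apply, pow_zero] at h5
  rw [← h5]
  have h6 : ∑' a, coneFun par q o a x - ∑' a, coneFun par q o (a + 1) x = coneFun par q o 0 x := by
    rw [← h4]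
    simp
  exact h6 ▸ h3

theorem norm_coneDiff_summable (par : V → V) (hq : 2 ≤ q) (o x : V) :
    Summable fun a => ‖coneDiff par q o a x‖ :=
  ((summable_coneFun par hq o x).sub
    ((summable_nat_add_iff 1).2 (summable_coneFun par hq o x))).norm

theorem coneDiff_root (par : V → V) (q : ℕ) (o : V) (a : ℕ) :
    coneDiff par q o a o = ((q : ℝ)⁻¹) ^ a * (1 - (q : ℝ)⁻¹) := by
  rw [coneDiff, coneFun, coneFun, if_pos ⟨a, rfl⟩, if_pos ⟨a + 1, rfl⟩]
  ring

end IsHoro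

end Tree

end DiestelLeader

namespace DiestelLeader

section Trig

open Real Finset

theorem sum_cos_mul_pi_div (k : ℕ) (hk : k ≠ 0) (n : ℤ) (hn : ¬ (2 * k : ℤ) ∣ n) :
    ∑ j ∈ range (2 * k), cos (π * j / k * n) = 0 := by
  have hkC : (k : ℂ) ≠ 0 := by exact_mod_cast hk
  set w : ℂ := Complex.exp (π / k * n * Complex.I) with hw
  have hpi : (π : ℂ) ≠ 0 := by exact_mod_cast pi_ne_zero
  have hw1 : w ≠ 1 := by
    rw [hw, Ne, Complex.exp_eq_one_iff]
    rintro ⟨m, hm⟩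
    refine hn ⟨m, ?_⟩
    have : (n : ℂ) = 2 * k * m := by
      have hI := Complex.I_ne_zero
      field_simp at hm
      linear_combination hm
    exact_mod_cast this
  have hwk : w ^ (2 * k) = 1 := by
    rw [hw, ← Complex.exp_nat_mul, Complex.exp_eq_one_iff]
    refine ⟨n, ?_⟩
    push_cast
    field_simp
  have hsum : ∑ j ∈ range (2 * k), w ^ j = 0 := by
    rw [geom_sum_eq hw1, hwk, sub_self, zero_div]
  have := congrArg Complex.re hsum
  rw [Complex.re_sum, Complex.zero_re] at this
  rw [← this]
  refine sum_congr rfl fun j _ => ?_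
  rw [hw, ← Complex.exp_nat_mul]
  have : (j : ℂ) * (π / k * n * Complex.I) = ((π * j / k * n : ℝ) : ℂ) * Complex.I := by
    push_cast
    ring
  rw [this, Complex.exp_ofReal_mul_I_re]

theorem sum_sin_mul_sin (k : ℕ) (m l : ℤ) (hm : 0 < m) (hmk : m < k) (hl : 0 < l) (hlk : l < k) :
    ∑ j ∈ range (2 * k), sin (π * j / k * m) * sin (π * j / k * l) =
      if m = l then (k : ℝ) else 0 := by
  have hk : k ≠ 0 := by omega
  have h1 : ∀ j : ℕ, sin (π * j / k * m) * sin (π * j / k * l) =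
      (cos (π * j / k * (m - l : ℤ)) - cos (π * j / k * (m + l : ℤ))) / 2 := by
    intro j
    push_cast
    rw [mul_sub, mul_add, cos_sub, cos_add]
    ring
  have h2 : ¬ (2 * k : ℤ) ∣ m + l := fun h => by
    have := Int.le_of_dvd (by omega) h
    omega
  simp_rw [h1]
  rw [← sum_div, sum_sub_distrib, sum_cos_mul_pi_div k hk _ h2, sub_zero]
  split_ifs with h
  · simp [h]
  · have h3 : ¬ (2 * k : ℤ) ∣ m - l := fun h' => by
      have := Int.eq_zero_of_abs_lt_dvd h' (by rw [abs_lt]; omega)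
      omega
    rw [sum_cos_mul_pi_div k hk _ h3, zero_div]

end Trig

section Kernel

open Real Finset

/-- The number `2 √(q r) / (q + r)`. -/
noncomputable def rhoDL (q r : ℕ) : ℝ := 2 * √((q : ℝ) * r) / ((q : ℝ) + r)

/-- The Dirichlet kernel on `{-a, …, b}` of the walk with weights `q / (q + r)` and `r / (q + r)`,
as a sum over the eigenfunctions; it satisfies the recursion on all of `ℤ`. -/
noncomputable def dlWave (q r N a b : ℕ) (h : ℤ) : ℝ :=
  (√r / √q) ^ h * ((a + b + 2 : ℕ) : ℝ)⁻¹ * ∑ j ∈ range (2 * (a + b + 2)),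
    (rhoDL q r * cos (π * j / (a + b + 2 : ℕ))) ^ N *
      (sin (π * j / (a + b + 2 : ℕ) * ((h + a + 1 : ℤ) : ℝ)) *
        sin (π * j / (a + b + 2 : ℕ) * ((a + 1 : ℤ) : ℝ)))

/-- `dlWave`, cut off outside `{-a, …, b}`. -/
noncomputable def dlKern (q r N a b : ℕ) (h : ℤ) : ℝ :=
  if -(a : ℤ) ≤ h ∧ h ≤ b then dlWave q r N a b h else 0

variable {q r : ℕ}

theorem dlKern_zero (a b : ℕ) (h : ℤ) :
    dlKern q r 0 a b h = if h = 0 then 1 else 0 := by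
  unfold dlKern
  split_ifs with h1 h2 h2
  · subst h2
    simp only [dlWave, pow_zero, one_mul, zpow_zero]
    rw [sum_sin_mul_sin (a + b + 2) _ _ (by omega) (by push_cast; omega) (by omega)
      (by push_cast; omega), if_pos (by ring), inv_mul_cancel₀]
    positivity
  · simp only [dlWave, pow_zero, one_mul]
    rw [sum_sin_mul_sin (a + b + 2) _ _ (by omega) (by push_cast; omega) (by omega)
      (by push_cast; omega), if_neg (by omega), mul_zero]
  · omega
  · rfl

theorem dlWave_left (N a b : ℕ) : dlWave q r N a b (-a - 1) = 0 := by
  unfold dlWave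
  rw [sum_eq_zero, mul_zero]
  intro j _
  have : ((-a - 1 + a + 1 : ℤ) : ℝ) = 0 := by push_cast; ring
  rw [this]
  simp

theorem dlWave_right (N a b : ℕ) : dlWave q r N a b (b + 1) = 0 := by
  unfold dlWave
  rw [sum_eq_zero, mul_zero]
  intro j _
  have : π * j / (a + b + 2 : ℕ) * ((b + 1 + a + 1 : ℤ) : ℝ) = j * π := by
    have : ((a : ℝ) + b + 2) ≠ 0 := by positivity
    push_cast
    field_simp
    ring
  rw [this, sin_nat_mul_pi]
  simp

theorem dlWave_succ (hq : 2 ≤ q) (hr : 2 ≤ r) (N a b : ℕ) (h : ℤ) :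
    (q * dlWave q r N a b (h + 1) + r * dlWave q r N a b (h - 1)) / ((q : ℝ) + r) =
      dlWave q r (N + 1) a b h := by
  have hq0 : (0 : ℝ) < q := by positivity
  have hr0 : (0 : ℝ) < r := by positivity
  have hsq : √(q : ℝ) ≠ 0 := by positivity
  have hsr : √(r : ℝ) ≠ 0 := by positivity
  have hqq : (q : ℝ) = √q * √q := (mul_self_sqrt hq0.le).symm
  have hrr : (r : ℝ) = √r * √r := (mul_self_sqrt hr0.le).symm
  have h0 : √(r : ℝ) / √q ≠ 0 := by positivity
  have e1 : (q : ℝ) * (√r / √q) ^ (h + 1) = √(q * r) * (√r / √q) ^ h := by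
    rw [zpow_add_one₀ h0, sqrt_mul hq0.le]
    nth_rewrite 1 [hqq]
    field_simp
  have e2 : (r : ℝ) * (√r / √q) ^ (h - 1) = √(q * r) * (√r / √q) ^ h := by
    rw [zpow_sub_one₀ h0, sqrt_mul hq0.le]
    nth_rewrite 1 [hrr]
    field_simp
  unfold dlWave
  rw [← mul_assoc, ← mul_assoc, ← mul_assoc, ← mul_assoc, e1, e2, ← mul_add, ← sum_add_distrib,
    mul_sum, mul_sum, sum_div]
  refine sum_congr rfl fun j _ => ?_
  set θ : ℝ := π * j / (a + b + 2 : ℕ)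
  have e3 : sin (θ * ((h + 1 + a + 1 : ℤ) : ℝ)) + sin (θ * ((h - 1 + a + 1 : ℤ) : ℝ)) =
      2 * cos θ * sin (θ * ((h + a + 1 : ℤ) : ℝ)) := by
    have e4 : θ * ((h + 1 + a + 1 : ℤ) : ℝ) = θ * ((h + a + 1 : ℤ) : ℝ) + θ := by push_cast; ring
    have e5 : θ * ((h - 1 + a + 1 : ℤ) : ℝ) = θ * ((h + a + 1 : ℤ) : ℝ) - θ := by push_cast; ring
    rw [e4, e5, sin_add, sin_sub]
    ring
  rw [pow_succ, ← mul_add, ← add_mul, e3, rhoDL]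
  ring

theorem dlKern_succ (hq : 2 ≤ q) (hr : 2 ≤ r) (N a b : ℕ) {h : ℤ} (h1 : -(a : ℤ) ≤ h)
    (h2 : h ≤ b) :
    (q * dlKern q r N a b (h + 1) + r * dlKern q r N a b (h - 1)) / ((q : ℝ) + r) =
      dlKern q r (N + 1) a b h := by
  have e1 : dlKern q r N a b (h + 1) = dlWave q r N a b (h + 1) := by
    unfold dlKern
    split_ifs with h3
    · rfl
    · have : h = b := by omega
      rw [this, dlWave_right]
  have e2 : dlKern q r N a b (h - 1) = dlWave q r N a b (h - 1) := by
    unfold dlKern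
    split_ifs with h3
    · rfl
    · have : h = -(a : ℤ) := by omega
      rw [this, dlWave_left]
  rw [e1, e2, dlWave_succ hq hr, dlKern, if_pos ⟨h1, h2⟩]

end Kernel

section Walk

variable {X : Type*} {G : SimpleGraph X}

theorem srwStep_eq {nb : X → Finset X} {d : ℕ} (hnb : ∀ x y, y ∈ nb x ↔ G.Adj x y)
    (hd : ∀ x, (nb x).card = d) [DecidableEq X] (x y : X) :
    srwStep G x y = if y ∈ nb x then (d : ℝ)⁻¹ else 0 := by
  have : G.neighborSet x = nb x := by
    ext z
    simp [hnb]
  unfold srwStep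
  rw [this, Set.ncard_coe_finset, hd, one_div]
  split_ifs with h1 h2 h2
  · rfl
  · exact absurd ((hnb x y).2 h1) h2
  · exact absurd ((hnb x y).1 h2) h1
  · rfl

theorem tsum_srwStep_mul {nb : X → Finset X} {d : ℕ} (hnb : ∀ x y, y ∈ nb x ↔ G.Adj x y)
    (hd : ∀ x, (nb x).card = d) (x : X) (f : X → ℝ) :
    ∑' y, srwStep G x y * f y = (∑ y ∈ nb x, f y) / d := by
  classical
  rw [tsum_eq_sum (s := nb x), Finset.sum_div]
  · refine Finset.sum_congr rfl fun y hy => ?_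
    rw [srwStep_eq hnb hd, if_pos hy]
    ring
  · intro y hy
    rw [srwStep_eq hnb hd, if_neg hy, zero_mul]

end Walk

section Product

open Finset

variable {V₁ V₂ : Type*} {T₁ : SimpleGraph V₁} {T₂ : SimpleGraph V₂} {ω₁ : ℕ → V₁} {ω₂ : ℕ → V₂}
  {o₁ : V₁} {o₂ : V₂} {par₁ : V₁ → V₁} {par₂ : V₂ → V₂} {ch₁ : V₁ → Finset V₁}
  {ch₂ : V₂ → Finset V₂} {q r : ℕ}

theorem exists_neighborFinset (H₁ : IsHoro T₁ (busemann T₁ ω₁ o₁) par₁ ch₁ q)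
    (H₂ : IsHoro T₂ (busemann T₂ ω₂ o₂) par₂ ch₂ r) :
    ∃ nb : DLVertex T₁ T₂ ω₁ ω₂ o₁ o₂ → Finset (DLVertex T₁ T₂ ω₁ ω₂ o₁ o₂),
      (∀ x y, y ∈ nb x ↔ (DLGraph T₁ T₂ ω₁ ω₂ o₁ o₂).Adj x y) ∧ (∀ x, (nb x).card = q + r) ∧
      ∀ x (F : V₁ × V₂ → ℝ), ∑ y ∈ nb x, F y.1 =
        ∑ y ∈ ch₁ x.1.1, F (y, par₂ x.1.2) + ∑ y ∈ ch₂ x.1.2, F (par₁ x.1.1, y) := by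
  classical
  set S : V₁ × V₂ → Finset (V₁ × V₂) := fun x =>
    (ch₁ x.1 ×ˢ {par₂ x.2}) ∪ ({par₁ x.1} ×ˢ ch₂ x.2) with hS
  have hmem : ∀ x y, y ∈ S x ↔ (par₁ y.1 = x.1 ∧ y.2 = par₂ x.2) ∨
      (y.1 = par₁ x.1 ∧ par₂ y.2 = x.2) := by
    intro x y
    simp only [hS, mem_union, mem_product, mem_singleton, H₁.mem_ch, H₂.mem_ch]
  have hdisj : ∀ x : V₁ × V₂, Disjoint (ch₁ x.1 ×ˢ {par₂ x.2}) ({par₁ x.1} ×ˢ ch₂ x.2) := by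
    intro x
    rw [Finset.disjoint_left]
    rintro ⟨y, z⟩ h1 h2
    simp only [mem_product, mem_singleton, H₁.mem_ch, H₂.mem_ch] at h1 h2
    have e1 := H₁.h_par y
    have e2 := H₁.h_par x.1
    rw [h1.1] at e1
    rw [← h2.1] at e2
    omega
  have hp : ∀ x : DLVertex T₁ T₂ ω₁ ω₂ o₁ o₂, ∀ y ∈ S x.1,
      busemann T₁ ω₁ o₁ y.1 + busemann T₂ ω₂ o₂ y.2 = 0 := by
    rintro ⟨⟨x₁, x₂⟩, hx⟩ ⟨y₁, y₂⟩ hy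
    rw [hmem] at hy
    have e1 := H₁.h_par y₁
    have e2 := H₁.h_par x₁
    have e3 := H₂.h_par y₂
    have e4 := H₂.h_par x₂
    simp only at hx hy ⊢
    rcases hy with ⟨h1, h2⟩ | ⟨h1, h2⟩
    · rw [h1] at e1
      rw [h2]
      omega
    · rw [h2] at e3
      rw [h1]
      omega
  have hsum : ∀ (x : DLVertex T₁ T₂ ω₁ ω₂ o₁ o₂) (F : V₁ × V₂ → ℝ),
      ∑ y ∈ (S x.1).subtype
        (fun y => busemann T₁ ω₁ o₁ y.1 + busemann T₂ ω₂ o₂ y.2 = 0), F y.1 =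
        ∑ y ∈ ch₁ x.1.1, F (y, par₂ x.1.2) + ∑ y ∈ ch₂ x.1.2, F (par₁ x.1.1, y) := by
    intro x F
    rw [Finset.sum_subtype_of_mem F (hp x), hS, sum_union (hdisj _), sum_product, sum_product]
    simp
  refine ⟨fun x => (S x.1).subtype _, ?_, ?_, hsum⟩
  · rintro ⟨⟨x₁, x₂⟩, hx⟩ ⟨⟨y₁, y₂⟩, hy⟩
    rw [Finset.mem_subtype, hmem]
    simp only [DLGraph, H₁.adj_iff, H₂.adj_iff]
    constructor
    · rintro (⟨h1, h2⟩ | ⟨h1, h2⟩)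
      · exact ⟨Or.inr h1, Or.inl h2.symm⟩
      · exact ⟨Or.inl h1.symm, Or.inr h2⟩
    · have e1 := H₁.h_par y₁
      have e2 := H₁.h_par x₁
      have e3 := H₂.h_par y₂
      have e4 := H₂.h_par x₂
      simp only at hx hy
      rintro ⟨h1 | h1, h2 | h2⟩
      · rw [h1] at e2
        rw [h2] at e4
        omega
      · exact Or.inr ⟨h1.symm, h2⟩
      · exact Or.inl ⟨h1, h2.symm⟩
      · rw [h1] at e1
        rw [h2] at e3
        omega
  · intro x
    have := hsum x (fun _ => 1)
    simp only [sum_const, nsmul_eq_mul, mul_one, H₁.card_ch, H₂.card_ch] at this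
    exact_mod_cast this

theorem step_coneDiff_mul (H₁ : IsHoro T₁ (busemann T₁ ω₁ o₁) par₁ ch₁ q)
    (H₂ : IsHoro T₂ (busemann T₂ ω₂ o₂) par₂ ch₂ r) (hq : 2 ≤ q) (hr : 2 ≤ r)
    (x : DLVertex T₁ T₂ ω₁ ω₂ o₁ o₂) (N a b : ℕ) :
    (∑ y ∈ ch₁ x.1.1, coneDiff par₁ q o₁ a y * coneDiff par₂ r o₂ b (par₂ x.1.2) *
          dlKern q r N a b (busemann T₁ ω₁ o₁ y) +
        ∑ y ∈ ch₂ x.1.2, coneDiff par₁ q o₁ a (par₁ x.1.1) * coneDiff par₂ r o₂ b y *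
          dlKern q r N a b (busemann T₁ ω₁ o₁ (par₁ x.1.1))) / ((q : ℝ) + r) =
      coneDiff par₁ q o₁ a x.1.1 * coneDiff par₂ r o₂ b x.1.2 *
        dlKern q r (N + 1) a b (busemann T₁ ω₁ o₁ x.1.1) := by
  obtain ⟨⟨x₁, x₂⟩, hx⟩ := x
  simp only at hx ⊢
  have ho₁ := busemann_root T₁ ω₁ o₁
  have ho₂ := busemann_root T₂ ω₂ o₂
  have h1 : ∀ y ∈ ch₁ x₁, busemann T₁ ω₁ o₁ y = busemann T₁ ω₁ o₁ x₁ + 1 := by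
    intro y hy
    obtain rfl := (H₁.mem_ch _ _).1 hy
    have := H₁.h_par y
    omega
  have hpar₂ := H₂.h_par x₂
  rw [H₁.h_par x₁]
  generalize hh : busemann T₁ ω₁ o₁ x₁ = h at *
  have e1 : ∑ y ∈ ch₁ x₁, coneDiff par₁ q o₁ a y * coneDiff par₂ r o₂ b (par₂ x₂) *
      dlKern q r N a b (busemann T₁ ω₁ o₁ y) =
      (∑ y ∈ ch₁ x₁, coneDiff par₁ q o₁ a y) * coneDiff par₂ r o₂ b (par₂ x₂) *
        dlKern q r N a b (h + 1) := by
    rw [sum_mul, sum_mul]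
    exact sum_congr rfl fun y hy => by rw [h1 y hy]
  have e2 : ∑ y ∈ ch₂ x₂, coneDiff par₁ q o₁ a (par₁ x₁) * coneDiff par₂ r o₂ b y *
      dlKern q r N a b (h - 1) = coneDiff par₁ q o₁ a (par₁ x₁) *
        (∑ y ∈ ch₂ x₂, coneDiff par₂ r o₂ b y) * dlKern q r N a b (h - 1) := by
    rw [mul_sum, sum_mul]
  rw [e1, e2]
  have e3 : (∑ y ∈ ch₁ x₁, coneDiff par₁ q o₁ a y) * coneDiff par₂ r o₂ b (par₂ x₂) *
      dlKern q r N a b (h + 1) = if -(a : ℤ) ≤ h then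
        q * (coneDiff par₁ q o₁ a x₁ * coneDiff par₂ r o₂ b x₂ * dlKern q r N a b (h + 1)) else 0 := by
    split_ifs with h3
    · rw [H₁.sum_coneDiff_child ho₁ (by omega)]
      by_cases h4 : h + 1 ≤ b
      · rw [← H₂.coneDiff_child ho₂ (y := x₂) (by omega)]
        ring
      · have : dlKern q r N a b (h + 1) = 0 := if_neg (by omega)
        rw [this]
        ring
    · by_cases h4 : h = -(a : ℤ) - 1
      · rw [H₁.sum_coneDiff_child_eq_zero (by omega) ho₁ (by omega)]
        ring
      · have : dlKern q r N a b (h + 1) = 0 := if_neg (by omega)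
        rw [this, mul_zero]
  have e4 : coneDiff par₁ q o₁ a (par₁ x₁) * (∑ y ∈ ch₂ x₂, coneDiff par₂ r o₂ b y) *
      dlKern q r N a b (h - 1) = if h ≤ b then
        r * (coneDiff par₁ q o₁ a x₁ * coneDiff par₂ r o₂ b x₂ * dlKern q r N a b (h - 1)) else 0 := by
    split_ifs with h3
    · rw [H₂.sum_coneDiff_child ho₂ (by omega)]
      by_cases h4 : -(a : ℤ) ≤ h - 1
      · have := H₁.h_par x₁
        rw [← H₁.coneDiff_child ho₁ (y := x₁) (by omega)]
        ring
      · have : dlKern q r N a b (h - 1) = 0 := if_neg (by omega)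
        rw [this]
        ring
    · by_cases h4 : h = b + 1
      · rw [H₂.sum_coneDiff_child_eq_zero (by omega) ho₂ (by omega)]
        ring
      · have : dlKern q r N a b (h - 1) = 0 := if_neg (by omega)
        rw [this, mul_zero]
  rw [e3, e4]
  by_cases h5 : -(a : ℤ) ≤ h ∧ h ≤ b
  · rw [if_pos h5.1, if_pos h5.2, ← dlKern_succ hq hr N a b h5.1 h5.2]
    ring
  · have e5 : dlKern q r (N + 1) a b h = 0 := if_neg h5
    rw [e5, mul_zero]
    split_ifs with h6 h7 h7
    · exact absurd ⟨h6, h7⟩ h5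
    · have : dlKern q r N a b (h + 1) = 0 := if_neg (by omega)
      rw [this]
      ring
    · have : dlKern q r N a b (h - 1) = 0 := if_neg (by omega)
      rw [this]
      ring
    · simp

theorem hasSum_srwProb (H₁ : IsHoro T₁ (busemann T₁ ω₁ o₁) par₁ ch₁ q)
    (H₂ : IsHoro T₂ (busemann T₂ ω₂ o₂) par₂ ch₂ r) (hq : 2 ≤ q) (hr : 2 ≤ r) (N : ℕ)
    (x : DLVertex T₁ T₂ ω₁ ω₂ o₁ o₂) :
    HasSum (fun p : ℕ × ℕ => coneDiff par₁ q o₁ p.1 x.1.1 * coneDiff par₂ r o₂ p.2 x.1.2 *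
        dlKern q r N p.1 p.2 (busemann T₁ ω₁ o₁ x.1.1))
      (srwProb (DLGraph T₁ T₂ ω₁ ω₂ o₁ o₂) N x (DLRoot T₁ T₂ ω₁ ω₂ o₁ o₂)) := by
  classical
  have ho₁ := busemann_root T₁ ω₁ o₁
  have ho₂ := busemann_root T₂ ω₂ o₂
  induction N generalizing x with
  | zero =>
    simp only [dlKern_zero, srwProb]
    by_cases hx : busemann T₁ ω₁ o₁ x.1.1 = 0
    · have hx₂ : busemann T₂ ω₂ o₂ x.1.2 = 0 := by have := x.2; omega
      have h1 := H₁.hasSum_coneDiff hq ho₁ hx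
      have h2 := H₂.hasSum_coneDiff hr ho₂ hx₂
      have h3 := h1.mul h2 (summable_mul_of_summable_norm
        (f := fun a => coneDiff par₁ q o₁ a x.1.1) (g := fun a => coneDiff par₂ r o₂ a x.1.2)
        (IsHoro.norm_coneDiff_summable par₁ hq o₁ x.1.1)
        (IsHoro.norm_coneDiff_summable par₂ hr o₂ x.1.2))
      simp only [hx, if_true, mul_one]
      convert! h3 using 1
      have : x = DLRoot T₁ T₂ ω₁ ω₂ o₁ o₂ ↔ x.1.1 = o₁ ∧ x.1.2 = o₂ := by
        rw [Subtype.ext_iff, Prod.ext_iff]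
        rfl
      by_cases h4 : x.1.1 = o₁ <;> by_cases h5 : x.1.2 = o₂ <;> simp [this, h4, h5]
    · have hne : x ≠ DLRoot T₁ T₂ ω₁ ω₂ o₁ o₂ := by
        rintro rfl
        exact hx ho₁
      simp only [hx, hne, if_false, mul_zero]
      exact hasSum_zero
  | succ N ih =>
    obtain ⟨nb, hnb, hd, hsum⟩ := exists_neighborFinset H₁ H₂
    have h0 : srwProb (DLGraph T₁ T₂ ω₁ ω₂ o₁ o₂) (N + 1) x (DLRoot T₁ T₂ ω₁ ω₂ o₁ o₂) =
        (∑ y ∈ nb x, srwProb (DLGraph T₁ T₂ ω₁ ω₂ o₁ o₂) N y (DLRoot T₁ T₂ ω₁ ω₂ o₁ o₂)) /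
          ((q + r : ℕ) : ℝ) := by
      rw [srwProb]
      exact tsum_srwStep_mul hnb hd x _
    have h1 : HasSum (fun p : ℕ × ℕ => (∑ y ∈ nb x, coneDiff par₁ q o₁ p.1 y.1.1 *
        coneDiff par₂ r o₂ p.2 y.1.2 * dlKern q r N p.1 p.2 (busemann T₁ ω₁ o₁ y.1.1)) /
          ((q + r : ℕ) : ℝ)) ((∑ y ∈ nb x, srwProb (DLGraph T₁ T₂ ω₁ ω₂ o₁ o₂) N y
            (DLRoot T₁ T₂ ω₁ ω₂ o₁ o₂)) / ((q + r : ℕ) : ℝ)) :=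
      (hasSum_sum fun y _ => ih y).div_const _
    rw [h0]
    refine h1.congr_fun fun p => ?_
    rw [← step_coneDiff_mul H₁ H₂ hq hr, hsum x (fun y => coneDiff par₁ q o₁ p.1 y.1 *
      coneDiff par₂ r o₂ p.2 y.2 * dlKern q r N p.1 p.2 (busemann T₁ ω₁ o₁ y.1)), Nat.cast_add]

theorem hasSum_srwProb_root (H₁ : IsHoro T₁ (busemann T₁ ω₁ o₁) par₁ ch₁ q)
    (H₂ : IsHoro T₂ (busemann T₂ ω₂ o₂) par₂ ch₂ r) (hq : 2 ≤ q) (hr : 2 ≤ r) (N : ℕ) :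
    HasSum (fun p : ℕ × ℕ => ((q : ℝ)⁻¹ ^ p.1 * (1 - (q : ℝ)⁻¹)) * ((r : ℝ)⁻¹ ^ p.2 * (1 - (r : ℝ)⁻¹)) *
        (((p.1 + p.2 + 2 : ℕ) : ℝ)⁻¹ * ∑ j ∈ range (2 * (p.1 + p.2 + 2)),
          (rhoDL q r * Real.cos (Real.pi * j / (p.1 + p.2 + 2 : ℕ))) ^ N *
            Real.sin (Real.pi * j / (p.1 + p.2 + 2 : ℕ) * (p.1 + 1 : ℕ)) ^ 2))
      (srwProb (DLGraph T₁ T₂ ω₁ ω₂ o₁ o₂) N (DLRoot T₁ T₂ ω₁ ω₂ o₁ o₂)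
        (DLRoot T₁ T₂ ω₁ ω₂ o₁ o₂)) := by
  have := hasSum_srwProb H₁ H₂ hq hr N (DLRoot T₁ T₂ ω₁ ω₂ o₁ o₂)
  convert this using 1
  ext p
  simp only [DLRoot, IsHoro.coneDiff_root, busemann_root, dlKern, dlWave]
  rw [if_pos (by omega), zpow_zero, one_mul]
  congr 2
  refine sum_congr rfl fun j _ => ?_
  push_cast
  rw [zero_add]
  ring

end Product

end DiestelLeader

namespace DiestelLeader

section Operator

open Finset Filter Topology
open scoped ENNReal

variable {X : Type*} {G : SimpleGraph X}

theorem sum_norm_sq_avg_le {nb : X → Finset X} {d : ℕ} (hnb : ∀ x y, y ∈ nb x ↔ G.Adj x y)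
    (hd0 : d ≠ 0) {m : X → ℝ} (hm : ∀ x, 0 < m x) {ρ : ℝ} (hρ : 0 ≤ ρ)
    (hsum : ∀ x, ∑ y ∈ nb x, m y = d * ρ * m x) (f : X → ℂ) (C : ℝ)
    (hC : ∀ t : Finset X, ∑ y ∈ t, ‖f y‖ ^ 2 ≤ C) (s : Finset X) :
    ∑ x ∈ s, ‖(∑ y ∈ nb x, f y) / (d : ℂ)‖ ^ 2 ≤ ρ ^ 2 * C := by
  classical
  have hdpos : (0 : ℝ) < d := by positivity
  have hsymm : ∀ x y, y ∈ nb x ↔ x ∈ nb y := fun x y => by rw [hnb, hnb, G.adj_comm]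
  have h1 : ∀ x, ‖(∑ y ∈ nb x, f y) / (d : ℂ)‖ ^ 2 ≤
      ∑ y ∈ nb x, ρ / d * (m x * (‖f y‖ ^ 2 / m y)) := by
    intro x
    have h2 : ‖∑ y ∈ nb x, f y‖ ^ 2 ≤ (∑ y ∈ nb x, m y) * ∑ y ∈ nb x, ‖f y‖ ^ 2 / m y := by
      refine (pow_le_pow_left₀ (norm_nonneg _) (norm_sum_le _ _) 2).trans ?_
      refine sum_sq_le_sum_mul_sum_of_sq_le_mul _ (fun y _ => (hm y).le)
        (fun y _ => div_nonneg (sq_nonneg _) (hm y).le) fun y _ => le_of_eq ?_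
      have := (hm y).ne'
      field_simp
    rw [norm_div, div_pow, Complex.norm_natCast, div_le_iff₀ (by positivity)]
    refine h2.trans (le_of_eq ?_)
    rw [hsum, ← mul_sum, ← mul_sum]
    field_simp
  refine (sum_le_sum fun x _ => h1 x).trans ?_
  have h3 : ∑ x ∈ s, ∑ y ∈ nb x, ρ / d * (m x * (‖f y‖ ^ 2 / m y)) =
      ∑ y ∈ s.biUnion nb, ∑ x ∈ (nb y).filter (· ∈ s), ρ / d * (m x * (‖f y‖ ^ 2 / m y)) := by
    refine sum_comm' fun x y => ?_
    simp only [mem_filter, mem_biUnion]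
    constructor
    · rintro ⟨h1, h2⟩
      exact ⟨⟨(hsymm x y).1 h2, h1⟩, x, h1, h2⟩
    · rintro ⟨⟨h1, h2⟩, -⟩
      exact ⟨h2, (hsymm x y).2 h1⟩
  rw [h3]
  calc _ ≤ ∑ y ∈ s.biUnion nb, ∑ x ∈ nb y, ρ / d * (m x * (‖f y‖ ^ 2 / m y)) := by
        refine sum_le_sum fun y _ => sum_le_sum_of_subset_of_nonneg (filter_subset _ _) ?_
        intro x _ _
        have := hm x
        have := hm y
        positivity
    _ = ∑ y ∈ s.biUnion nb, ρ ^ 2 * ‖f y‖ ^ 2 := by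
        refine sum_congr rfl fun y _ => ?_
        rw [← mul_sum, ← sum_mul, hsum]
        have := (hm y).ne'
        field_simp
    _ ≤ ρ ^ 2 * C := by
        rw [← mul_sum]
        exact mul_le_mul_of_nonneg_left (hC _) (sq_nonneg _)

theorem exists_srwOperator {nb : X → Finset X} {d : ℕ} (hnb : ∀ x y, y ∈ nb x ↔ G.Adj x y)
    (hd : ∀ x, (nb x).card = d) (hd0 : d ≠ 0) {m : X → ℝ} (hm : ∀ x, 0 < m x) {ρ : ℝ} (hρ : 0 ≤ ρ)
    (hsum : ∀ x, ∑ y ∈ nb x, m y = d * ρ * m x) :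
    ∃ P : lp (fun _ : X => ℂ) 2 →L[ℂ] lp (fun _ : X => ℂ) 2, IsSRWOperator G P ∧ ‖P‖ ≤ ρ := by
  classical
  have h2 : (2 : ℝ≥0∞).toReal = (2 : ℕ) := by simp
  have h2pos : 0 < (2 : ℝ≥0∞).toReal := by simp
  have hC : ∀ (f : lp (fun _ : X => ℂ) 2) (t : Finset X), ∑ y ∈ t, ‖f y‖ ^ 2 ≤ ‖f‖ ^ 2 := by
    intro f t
    have := lp.sum_rpow_le_norm_rpow h2pos f t
    simpa only [h2, Real.rpow_natCast] using this
  have hkey := fun f : lp (fun _ : X => ℂ) 2 =>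
    sum_norm_sq_avg_le hnb hd0 hm hρ hsum f (‖f‖ ^ 2) (hC f)
  have hmem : ∀ f : lp (fun _ : X => ℂ) 2,
      Memℓp (fun x => (∑ y ∈ nb x, f y) / (d : ℂ)) 2 := by
    intro f
    refine memℓp_gen' (C := ρ ^ 2 * ‖f‖ ^ 2) fun s => ?_
    simpa only [h2, Real.rpow_natCast] using hkey f s
  let L : lp (fun _ : X => ℂ) 2 →ₗ[ℂ] lp (fun _ : X => ℂ) 2 :=
    { toFun := fun f => ⟨fun x => (∑ y ∈ nb x, f y) / (d : ℂ), hmem f⟩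
      map_add' := fun f g => by
        ext x
        change (∑ y ∈ nb x, (f y + g y)) / (d : ℂ) =
          (∑ y ∈ nb x, f y) / (d : ℂ) + (∑ y ∈ nb x, g y) / (d : ℂ)
        rw [sum_add_distrib, add_div]
      map_smul' := fun c f => by
        ext x
        simp [← mul_sum, mul_div_assoc] }
  have hL : ∀ f x, L f x = (∑ y ∈ nb x, f y) / (d : ℂ) := fun f x => rfl
  refine ⟨L.mkContinuous ρ fun f => ?_, fun f x => ?_, L.mkContinuous_norm_le hρ _⟩
  · refine lp.norm_le_of_forall_sum_le h2pos (by positivity) fun s => ?_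
    simp only [h2, Real.rpow_natCast, mul_pow]
    exact hkey f s
  · rw [LinearMap.mkContinuous_apply, hL, tsum_eq_sum (s := nb x), Finset.sum_div]
    · refine Finset.sum_congr rfl fun y hy => ?_
      rw [srwStep_eq hnb hd, if_pos hy]
      push_cast
      ring
    · intro y hy
      rw [srwStep_eq hnb hd, if_neg hy, Complex.ofReal_zero, zero_mul]

theorem IsSRWOperator.pow_single_apply [DecidableEq X]
    {P : lp (fun _ : X => ℂ) 2 →L[ℂ] lp (fun _ : X => ℂ) 2} (hP : IsSRWOperator G P) (N : ℕ)
    (x o : X) : (P ^ N) (lp.single 2 o (1 : ℂ)) x = (srwProb G N x o : ℂ) := by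
  induction N generalizing x with
  | zero =>
    rw [pow_zero, one_apply_eq_self, lp.single_apply, srwProb]
    by_cases h : x = o
    · subst h
      simp
    · simp [h]
  | succ N ih =>
    rw [pow_succ', mul_apply_eq_comp, hP, srwProb, Complex.ofReal_tsum]
    refine tsum_congr fun y => ?_
    rw [ih]
    push_cast
    rfl

theorem IsSRWOperator.abs_srwProb_le
    {P : lp (fun _ : X => ℂ) 2 →L[ℂ] lp (fun _ : X => ℂ) 2} (hP : IsSRWOperator G P) (N : ℕ)
    (x o : X) : |srwProb G N x o| ≤ ‖P ^ N‖ := by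
  classical
  rw [← Real.norm_eq_abs, ← Complex.norm_real, ← hP.pow_single_apply]
  refine (lp.norm_apply_le_norm (by simp) _ x).trans ?_
  refine ((P ^ N).le_opNorm _).trans ?_
  rw [lp.norm_single (by simp)]
  simp

theorem IsSRWOperator.spectralRadius_eq
    {P : lp (fun _ : X => ℂ) 2 →L[ℂ] lp (fun _ : X => ℂ) 2} (hP : IsSRWOperator G P) {ρ : ℝ}
    (hPρ : ‖P‖ ≤ ρ) (o : X)
    (hlow : ∀ c, 0 ≤ c → c < ρ → ∀ᶠ N : ℕ in atTop, c ^ (2 * N) ≤ srwProb G (2 * N) o o) :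
    (spectralRadius ℂ P).toReal = ρ := by
  have hρ : 0 ≤ ρ := (norm_nonneg P).trans hPρ
  have hG := spectrum.pow_norm_pow_one_div_tendsto_nhds_spectralRadius P
  have hle : spectralRadius ℂ P ≤ ENNReal.ofReal ρ := by
    refine le_of_tendsto hG ?_
    filter_upwards [eventually_gt_atTop 0] with n hn
    refine ENNReal.ofReal_le_ofReal ?_
    calc ‖P ^ n‖ ^ (1 / n : ℝ) ≤ (ρ ^ n) ^ (1 / n : ℝ) := by
          refine Real.rpow_le_rpow (norm_nonneg _) ?_ (by positivity)
          exact (norm_pow_le' P hn).trans (pow_le_pow_left₀ (norm_nonneg _) hPρ n)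
      _ = ρ := by
          rw [one_div, Real.pow_rpow_inv_natCast hρ hn.ne']
  have hge : ∀ c, 0 ≤ c → c < ρ → ENNReal.ofReal c ≤ spectralRadius ℂ P := by
    intro c hc hcρ
    have h2 : Tendsto (fun N : ℕ => 2 * N) atTop atTop :=
      tendsto_id.const_mul_atTop' (by norm_num)
    refine ge_of_tendsto (hG.comp h2) ?_
    filter_upwards [hlow c hc hcρ, eventually_gt_atTop 0] with N hN hN0
    refine ENNReal.ofReal_le_ofReal ?_
    have h3 : c ^ (2 * N) ≤ ‖P ^ (2 * N)‖ := hN.trans ((le_abs_self _).trans (hP.abs_srwProb_le _ o o))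
    calc c = (c ^ (2 * N)) ^ (1 / ((2 * N : ℕ) : ℝ)) := by
          rw [one_div, Real.pow_rpow_inv_natCast hc (by omega)]
      _ ≤ _ := Real.rpow_le_rpow (by positivity) h3 (by positivity)
  have hne : spectralRadius ℂ P ≠ ⊤ := ne_top_of_le_ne_top ENNReal.ofReal_ne_top hle
  refine le_antisymm ?_ (le_of_forall_lt_imp_le_of_dense fun c hc => ?_)
  · rw [← ENNReal.toReal_ofReal hρ]
    exact ENNReal.toReal_mono ENNReal.ofReal_ne_top hle
  · rcases le_total 0 c with h | h
    · rw [← ENNReal.toReal_ofReal h]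
      exact ENNReal.toReal_mono hne (hge c h hc)
    · exact h.trans ENNReal.toReal_nonneg

end Operator

section ProductOperator

variable {V₁ V₂ : Type*} {T₁ : SimpleGraph V₁} {T₂ : SimpleGraph V₂} {ω₁ : ℕ → V₁} {ω₂ : ℕ → V₂}
  {o₁ : V₁} {o₂ : V₂} {par₁ : V₁ → V₁} {par₂ : V₂ → V₂} {ch₁ : V₁ → Finset V₁}
  {ch₂ : V₂ → Finset V₂} {q r : ℕ}

theorem exists_dlOperator (H₁ : IsHoro T₁ (busemann T₁ ω₁ o₁) par₁ ch₁ q)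
    (H₂ : IsHoro T₂ (busemann T₂ ω₂ o₂) par₂ ch₂ r) (hq : 2 ≤ q) (hr : 2 ≤ r) :
    ∃ P : lp (fun _ : DLVertex T₁ T₂ ω₁ ω₂ o₁ o₂ => ℂ) 2 →L[ℂ]
        lp (fun _ : DLVertex T₁ T₂ ω₁ ω₂ o₁ o₂ => ℂ) 2,
      IsSRWOperator (DLGraph T₁ T₂ ω₁ ω₂ o₁ o₂) P ∧ ‖P‖ ≤ rhoDL q r := by
  obtain ⟨nb, hnb, hd, hsum⟩ := exists_neighborFinset H₁ H₂
  have hq0 : (0 : ℝ) < q := by positivity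
  have hr0 : (0 : ℝ) < r := by positivity
  have hsq : √(q : ℝ) ≠ 0 := by positivity
  have hsr : √(r : ℝ) ≠ 0 := by positivity
  have h0 : √(r : ℝ) / √q ≠ 0 := by positivity
  refine exists_srwOperator hnb hd (by omega)
    (m := fun x => (√(r : ℝ) / √q) ^ busemann T₁ ω₁ o₁ x.1.1) (fun x => by positivity)
    (by unfold rhoDL; positivity) fun x => ?_
  rw [hsum x (fun y => (√(r : ℝ) / √q) ^ busemann T₁ ω₁ o₁ y.1)]
  have h1 : ∀ y ∈ ch₁ x.1.1, (√(r : ℝ) / √q) ^ busemann T₁ ω₁ o₁ y =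
      (√(r : ℝ) / √q) ^ busemann T₁ ω₁ o₁ x.1.1 * (√(r : ℝ) / √q) := by
    intro y hy
    have e := H₁.h_par y
    rw [(H₁.mem_ch _ _).1 hy] at e
    rw [← zpow_add_one₀ h0, e]
    congr 1
    ring
  dsimp only
  rw [Finset.sum_congr rfl h1, Finset.sum_const, Finset.sum_const, H₁.card_ch, H₂.card_ch,
    H₁.h_par, zpow_sub_one₀ h0, rhoDL, nsmul_eq_mul, nsmul_eq_mul, Real.sqrt_mul hq0.le]
  have hqq : √(q : ℝ) ^ 2 = q := Real.sq_sqrt hq0.le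
  have hrr : √(r : ℝ) ^ 2 = r := Real.sq_sqrt hr0.le
  have hqr : (q : ℝ) + r ≠ 0 := by positivity
  push_cast
  field_simp
  rw [hqq, hrr]
  ring

end ProductOperator

end DiestelLeader

namespace DiestelLeader

section Laplace

open Real Filter Topology MeasureTheory Set

theorem integrable_exp_neg_mul_abs {b : ℝ} (hb : 0 < b) :
    Integrable fun v : ℝ => exp (-(b * |v|)) := by
  refine (integrable_inv_one_add_sq.const_mul (1 + 2 / b ^ 2)).mono'
    (by fun_prop) (Eventually.of_forall fun v => ?_)
  have h1 := pow_div_factorial_le_exp (x := b * |v|) (by positivity) 2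
  have h2 : 1 ≤ exp (b * |v|) := one_le_exp (by positivity)
  rw [mul_pow, sq_abs] at h1
  have h3 : v ^ 2 ≤ 2 / b ^ 2 * exp (b * |v|) := by
    rw [div_mul_eq_mul_div, le_div_iff₀ (by positivity)]
    norm_num [Nat.factorial] at h1
    linarith
  rw [norm_of_nonneg (exp_pos _).le, exp_neg, ← div_eq_mul_inv, le_div_iff₀ (by positivity),
    inv_mul_le_iff₀ (exp_pos _)]
  linarith

theorem cos_mul_exp_sq_le_one {x : ℝ} (h0 : 0 ≤ x) (h1 : x ≤ π / 2) :
    cos x * exp (x ^ 2 / 2) ≤ 1 := by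
  have hd : ∀ y, HasDerivAt (fun x : ℝ => cos x * exp (x ^ 2 / 2))
      (-sin y * exp (y ^ 2 / 2) + cos y * (exp (y ^ 2 / 2) * y)) y := by
    intro y
    have h2 : HasDerivAt (fun x : ℝ => x ^ 2 / 2) y y := by
      have := (hasDerivAt_pow 2 y).div_const 2
      simpa using this
    exact (hasDerivAt_cos y).mul h2.exp
  have hanti : AntitoneOn (fun x : ℝ => cos x * exp (x ^ 2 / 2)) (Icc 0 (π / 2)) := by
    refine antitoneOn_of_deriv_nonpos (convex_Icc _ _) (by fun_prop)
      (fun y _ => (hd y).differentiableAt.differentiableWithinAt) fun y hy => ?_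
    rw [interior_Icc] at hy
    rw [(hd y).deriv]
    have hc : 0 < cos y := cos_pos_of_mem_Ioo ⟨by linarith [hy.1, pi_pos], hy.2⟩
    have ht := le_tan hy.1.le hy.2
    rw [tan_eq_sin_div_cos, le_div_iff₀ hc] at ht
    have := exp_pos (y ^ 2 / 2)
    nlinarith
  have := hanti ⟨le_rfl, by positivity⟩ ⟨h0, h1⟩ h0
  simpa using this

theorem one_le_cos_mul_exp_sq {x : ℝ} (hx : x ^ 2 ≤ 1) :
    exp (-(x ^ 4 / 2)) ≤ cos x * exp (x ^ 2 / 2) := by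
  have h1 := one_sub_sq_div_two_le_cos (x := x)
  have h2 : (0 : ℝ) < 1 - x ^ 2 / 2 := by linarith
  have h3 := one_sub_inv_le_log_of_pos h2
  have h4 : -(x ^ 4 / 2) - x ^ 2 / 2 ≤ 1 - (1 - x ^ 2 / 2)⁻¹ := by
    rw [le_sub_iff_add_le, ← le_sub_iff_add_le', inv_le_iff_one_le_mul₀ h2]
    nlinarith [sq_nonneg x, mul_nonneg (sq_nonneg (x ^ 2)) (sub_nonneg.2 hx)]
  have h5 : exp (-(x ^ 4 / 2) - x ^ 2 / 2) ≤ cos x := by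
    refine (exp_le_exp.2 (h4.trans h3)).trans ?_
    rwa [exp_log h2]
  calc exp (-(x ^ 4 / 2)) = exp (-(x ^ 4 / 2) - x ^ 2 / 2) * exp (x ^ 2 / 2) := by
        rw [← exp_add]; ring_nf
    _ ≤ _ := by gcongr

theorem hasSum_inv_mul_of_integrable_floor {a : ℕ → ℝ} (ha : a 0 = 0) (K : ℝ) {s : ℝ} (hs : 0 < s)
    (hint : Integrable fun v : ℝ => a ⌊K + s * v⌋₊) :
    HasSum (fun n => s⁻¹ * a n) (∫ v : ℝ, a ⌊K + s * v⌋₊) := by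
  set I : ℕ → Set ℝ := fun n => Ico ((n - K) / s) ((n + 1 - K) / s) with hI
  have hmem : ∀ n v, v ∈ I n → ⌊K + s * v⌋₊ = n := by
    rintro n v ⟨h1, h2⟩
    rw [div_le_iff₀ hs] at h1
    rw [lt_div_iff₀ hs] at h2
    rw [Nat.floor_eq_iff (by linarith [n.cast_nonneg (α := ℝ)])]
    constructor <;> linarith
  have hdisj : Pairwise (Function.onFun Disjoint I) := by
    intro m n hmn
    refine Set.disjoint_left.2 fun v h1 h2 => hmn ?_
    rw [← hmem m v h1, hmem n v h2]
  have h1 := hasSum_integral_iUnion (μ := volume) (f := fun v : ℝ => a ⌊K + s * v⌋₊)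
    (s := I) (fun n => measurableSet_Ico) hdisj hint.integrableOn
  rw [setIntegral_eq_integral_of_forall_compl_eq_zero] at h1
  · refine h1.congr_fun fun n => ?_
    rw [setIntegral_congr_fun (g := fun _ => a n) measurableSet_Ico
      (fun v hv => by simp only [hmem n v hv]), setIntegral_const, smul_eq_mul]
    congr 1
    rw [measureReal_def, Real.volume_Ico, ENNReal.toReal_ofReal]
    · field_simp
      ring
    · rw [sub_nonneg]
      gcongr
      linarith
  · intro v hv
    have hneg : K + s * v < 0 := by
      by_contra! h
      refine hv (mem_iUnion.2 ⟨⌊K + s * v⌋₊, ?_, ?_⟩)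
      · rw [div_le_iff₀ hs]
        linarith [Nat.floor_le h]
      · rw [lt_div_iff₀ hs]
        linarith [Nat.lt_floor_add_one (K + s * v)]
    rw [Nat.floor_of_nonpos hneg.le, ha]

/-- `N ^ (1/6)`. -/
noncomputable def sixthRoot (N : ℕ) : ℝ := (N : ℝ) ^ ((1 : ℝ) / 6)

theorem sixthRoot_pow (N : ℕ) : sixthRoot N ^ 6 = N := by
  rw [sixthRoot, ← rpow_natCast, ← rpow_mul N.cast_nonneg]
  norm_num

theorem tendsto_sixthRoot : Tendsto sixthRoot atTop atTop :=
  (tendsto_rpow_atTop (by norm_num)).comp tendsto_natCast_atTop_atTop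

/-- The `k`-th term of the sum `∑ d k * k ^ (-α) * exp (-l k) * cos (π / k) ^ (2 N)`, divided by the
value at the maximum `K` of `K ^ (-α) * exp (-l k - N π ^ 2 / k ^ 2)`. -/
noncomputable def laplaceTerm (l : ℝ) (d : ℕ → ℝ) (α N : ℕ) (K : ℝ) (k : ℕ) : ℝ :=
  d k * ((K / k) ^ α * exp (-(l * ((k - K) ^ 2 * (2 * k + K) / (2 * k ^ 2)))) *
    (cos (π / k) * exp ((π / k) ^ 2 / 2)) ^ (2 * N))

theorem laplaceTerm_eq {l : ℝ} (d : ℕ → ℝ) (α N : ℕ) {K : ℝ} (hKN : K ^ 3 * l = 2 * π ^ 2 * N)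
    {k : ℕ} (hk : k ≠ 0) : laplaceTerm l d α N K k =
      d k * (k : ℝ)⁻¹ ^ α * exp (-(l * k)) * cos (π / k) ^ (2 * N) *
        (K ^ α * exp (3 / 2 * l * K)) := by
  have hk' : (k : ℝ) ≠ 0 := by exact_mod_cast hk
  have h1 : exp (-(l * ((k - K) ^ 2 * (2 * k + K) / (2 * k ^ 2)))) *
      exp ((π / k) ^ 2 / 2) ^ (2 * N) = exp (-(l * k)) * exp (3 / 2 * l * K) := by
    rw [← exp_nat_mul, ← exp_add, ← exp_add]
    congr 1
    push_cast
    field_simp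
    linear_combination (-1 : ℝ) * hKN
  rw [laplaceTerm, mul_pow, div_eq_mul_inv K, mul_pow]
  linear_combination d k * (K ^ α * (k : ℝ)⁻¹ ^ α) * cos (π / k) ^ (2 * N) * h1

theorem cosFactor_nonneg_le_one {k : ℕ} (hk : 2 ≤ k) (n : ℕ) :
    0 ≤ (cos (π / k) * exp ((π / k) ^ 2 / 2)) ^ n ∧
      (cos (π / k) * exp ((π / k) ^ 2 / 2)) ^ n ≤ 1 := by
  have hk' : (2 : ℝ) ≤ k := by exact_mod_cast hk
  have h1 : π / k ≤ π / 2 := by gcongr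
  have h0 : 0 ≤ π / k := by positivity
  have h2 : 0 ≤ cos (π / k) * exp ((π / k) ^ 2 / 2) :=
    mul_nonneg (cos_nonneg_of_mem_Icc ⟨by linarith [pi_pos], h1⟩) (exp_pos _).le
  exact ⟨pow_nonneg h2 _, pow_le_one₀ h2 (cos_mul_exp_sq_le_one h0 h1)⟩

theorem abs_laplaceTerm_le {l : ℝ} (hl : 0 < l) {d : ℕ → ℝ} {D : ℝ} (hD : ∀ k, |d k| ≤ D)
    (hd : ∀ k < 2, d k = 0) (α N : ℕ) {K s v : ℝ} (hK : 1 ≤ K) (hs : 0 < s) {ξ : ℝ} (hξ : 0 < ξ)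
    (hKs : K = (ξ * s) ^ 2) :
    |laplaceTerm l d α N K ⌊K + s * v⌋₊| ≤
      D * (α.factorial / l ^ α * exp (3 / 2 * l)) * exp l * exp (-(l / (2 * ξ) * |v|)) := by
  have hD0 : 0 ≤ D := (abs_nonneg _).trans (hD 0)
  set k := ⌊K + s * v⌋₊ with hk
  rcases lt_or_ge k 2 with hk2 | hk2
  · rw [laplaceTerm, hd k hk2, zero_mul, abs_zero]
    positivity
  have hk0 : (0 : ℝ) < k := by positivity
  have hfl : (k : ℝ) ≤ K + s * v := Nat.floor_le (by
    by_contra! h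
    rw [Nat.floor_of_nonpos h.le] at hk
    omega)
  have hfl' : K + s * v < k + 1 := Nat.lt_floor_add_one _
  obtain ⟨hc0, hc1⟩ := cosFactor_nonneg_le_one hk2 (2 * N)
  set t : ℝ := K / k with ht
  have ht0 : 0 < t := by positivity
  have h1 : (k - K) ^ 2 * (2 * k + K) / (2 * k ^ 2) = (k - K) ^ 2 / k + K * (t - 1) ^ 2 / 2 := by
    rw [ht]
    field_simp
    ring
  have h2 : t - 3 / 2 ≤ K * (t - 1) ^ 2 / 2 := by
    nlinarith [sq_nonneg (t - 2), sq_nonneg (t - 1)]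
  have hξs : 1 ≤ ξ * s := by
    have : 0 < ξ * s := by positivity
    nlinarith
  have h3 : |v| / (2 * ξ) - 1 ≤ (k - K) ^ 2 / k := by
    have h4 : s * |v| - 1 ≤ |(k : ℝ) - K| := by
      have h5 : |s * v| ≤ |(k : ℝ) - K| + 1 := by
        rw [abs_le]
        constructor <;> linarith [le_abs_self ((k : ℝ) - K), neg_abs_le ((k : ℝ) - K)]
      rw [abs_mul, abs_of_pos hs] at h5
      linarith
    have h5 : |(k : ℝ) - K| / (2 * (ξ * s)) - 1 / 2 ≤ (k - K) ^ 2 / k := by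
      set u := |(k : ℝ) - K| with hu
      have hu0 : 0 ≤ u := abs_nonneg _
      have hu2 : (k - K) ^ 2 = u ^ 2 := (sq_abs _).symm
      have hku : (k : ℝ) ≤ K + u := by linarith [le_abs_self ((k : ℝ) - K)]
      rw [hu2, le_div_iff₀ hk0]
      set w := ξ * s
      have hw : u / (2 * w) - 1 / 2 = (u - w) / (2 * w) := by field_simp
      rw [hw, div_mul_eq_mul_div, div_le_iff₀ (by positivity)]
      rcases le_or_gt u w with huw | huw
      · have : (u - w) * k ≤ 0 := mul_nonpos_of_nonpos_of_nonneg (by linarith) hk0.le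
        have : 0 ≤ u ^ 2 * (2 * w) := by positivity
        linarith
      · have h6 : (u - w) * k ≤ (u - w) * (w ^ 2 + u) :=
          mul_le_mul_of_nonneg_left (by rwa [hKs] at hku) (by linarith)
        have h7 : u * w * w ≤ u * w * u := by gcongr
        have h8 : u ^ 2 * 1 ≤ u ^ 2 * w := by gcongr
        have h9 : 0 ≤ w ^ 3 := by positivity
        have h10 : 0 ≤ w * u := by positivity
        nlinarith
    have h6 : (s * |v| - 1) / (2 * (ξ * s)) ≤ |(k : ℝ) - K| / (2 * (ξ * s)) := by gcongr
    have h7 : (s * |v| - 1) / (2 * (ξ * s)) = |v| / (2 * ξ) - 1 / (2 * (ξ * s)) := by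
      field_simp
    have h8 : 1 / (2 * (ξ * s)) ≤ 1 / 2 := by
      gcongr
      linarith
    linarith
  have h9 : t ^ α ≤ α.factorial / l ^ α * exp (l * t) := by
    have := pow_div_factorial_le_exp (x := l * t) (by positivity) α
    rw [mul_pow, div_le_iff₀ (by positivity)] at this
    rw [div_mul_eq_mul_div, le_div_iff₀ (by positivity)]
    linarith
  have h10 : t ^ α * exp (-(l * ((k - K) ^ 2 * (2 * k + K) / (2 * k ^ 2)))) ≤
      (α.factorial / l ^ α * exp (3 / 2 * l)) * exp l * exp (-(l / (2 * ξ) * |v|)) := by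
    calc _ ≤ α.factorial / l ^ α * exp (l * t) *
          exp (-(l * (|v| / (2 * ξ) - 1 + (t - 3 / 2)))) := by
          rw [h1]
          gcongr
      _ = _ := by
          rw [mul_assoc, ← exp_add, mul_assoc, mul_assoc, ← exp_add, ← exp_add]
          congr 2
          field_simp
          ring
  rw [laplaceTerm, abs_mul, abs_of_nonneg (mul_nonneg (by positivity) hc0)]
  calc _ ≤ D * ((t ^ α * exp (-(l * ((k - K) ^ 2 * (2 * k + K) / (2 * k ^ 2))))) * 1) := by
        gcongr
        exact hD k
    _ ≤ D * ((α.factorial / l ^ α * exp (3 / 2 * l)) * exp l * exp (-(l / (2 * ξ) * |v|))) := by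
        rw [mul_one]
        gcongr
    _ = _ := by ring

end Laplace

end DiestelLeader

namespace DiestelLeader

section Laplace

open Real Filter Topology MeasureTheory Set

theorem tendsto_laplaceTerm {l : ℝ} {d : ℕ → ℝ} {Λ : ℝ} (hΛ : Tendsto d atTop (𝓝 Λ))
    (α : ℕ) {c : ℝ} (hc : 0 < c) (v : ℝ) :
    Tendsto (fun N : ℕ => laplaceTerm l d α N ((c * sixthRoot N) ^ 2)
      ⌊(c * sixthRoot N) ^ 2 + sixthRoot N * v⌋₊) atTop
      (𝓝 (Λ * exp (-(3 * l / (2 * c ^ 2)) * v ^ 2))) := by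
  have hs := tendsto_sixthRoot
  have hsi : Tendsto (fun N => (sixthRoot N)⁻¹) atTop (𝓝 0) := tendsto_inv_atTop_zero.comp hs
  set K : ℕ → ℝ := fun N => (c * sixthRoot N) ^ 2 with hK
  set k : ℕ → ℕ := fun N => ⌊K N + sixthRoot N * v⌋₊ with hk
  set y : ℕ → ℝ := fun N => ((k N : ℝ) - K N) / sixthRoot N with hy
  set x : ℕ → ℝ := fun N => 1 + y N * (c ^ 2)⁻¹ * (sixthRoot N)⁻¹ with hx
  have hKtop : Tendsto K atTop atTop := (tendsto_pow_atTop (by norm_num)).comp (hs.const_mul_atTop hc)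
  have harg : Tendsto (fun N => K N + sixthRoot N * v) atTop atTop := by
    have h1 : Tendsto (fun N => c ^ 2 * sixthRoot N + v) atTop atTop :=
      tendsto_atTop_add_const_right _ _ (hs.const_mul_atTop (by positivity))
    refine (h1.atTop_mul_atTop₀ hs).congr fun N => ?_
    rw [hK]
    ring
  have hktop : Tendsto k atTop atTop := tendsto_nat_floor_atTop.comp harg
  have hyv : Tendsto y atTop (𝓝 v) := by
    have h1 : Tendsto (fun N => v - (sixthRoot N)⁻¹) atTop (𝓝 v) := by
      simpa using tendsto_const_nhds.sub hsi
    refine tendsto_of_tendsto_of_tendsto_of_le_of_le' h1 tendsto_const_nhds ?_ ?_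
    · filter_upwards [hs.eventually_gt_atTop 0] with N hN
      have := Nat.lt_floor_add_one (K N + sixthRoot N * v)
      rw [hy, le_div_iff₀ hN, sub_mul, inv_mul_cancel₀ hN.ne']
      simp only [hk]
      linarith
    · filter_upwards [hs.eventually_gt_atTop 0, harg.eventually_ge_atTop 0] with N hN h0
      have := Nat.floor_le h0
      rw [hy, div_le_iff₀ hN]
      simp only [hk]
      linarith
  have hx1 : Tendsto x atTop (𝓝 1) := by
    simpa using ((hyv.mul_const (c ^ 2)⁻¹).mul hsi).const_add 1
  have hkx : ∀ᶠ N in atTop, (k N : ℝ) = x N * K N := by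
    filter_upwards [hs.eventually_gt_atTop 0] with N hN
    simp only [hx, hy, hK]
    field_simp
    ring
  have hgood : ∀ᶠ N in atTop, 0 < sixthRoot N ∧ 0 < K N ∧ 0 < x N ∧ 4 ≤ k N ∧
      (k N : ℝ) = x N * K N := by
    filter_upwards [hs.eventually_gt_atTop 0, hKtop.eventually_gt_atTop 0,
      hx1.eventually_const_lt one_pos, hktop.eventually_ge_atTop 4, hkx] with N h1 h2 h3 h4 h5
    exact ⟨h1, h2, h3, h4, h5⟩
  have hexp : Tendsto (fun N => exp (-(l * ((k N - K N) ^ 2 * (2 * k N + K N) / (2 * k N ^ 2)))))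
      atTop (𝓝 (exp (-(3 * l / (2 * c ^ 2)) * v ^ 2))) := by
    have h1 : Tendsto (fun N => exp (-(l * (y N ^ 2 / c ^ 2 * ((2 * x N + 1) / (2 * x N ^ 2))))))
        atTop (𝓝 (exp (-(l * (v ^ 2 / c ^ 2 * ((2 * 1 + 1) / (2 * 1 ^ 2))))))) := by
      refine (continuous_exp.tendsto _).comp (Tendsto.neg (Tendsto.const_mul _ ?_))
      exact ((hyv.pow 2).div_const _).mul
        (((hx1.const_mul 2).add_const 1).div ((hx1.pow 2).const_mul 2) (by norm_num))
    have h2 : -(l * (v ^ 2 / c ^ 2 * ((2 * 1 + 1) / (2 * 1 ^ 2)))) =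
        -(3 * l / (2 * c ^ 2)) * v ^ 2 := by
      field_simp
      norm_num
    rw [h2] at h1
    refine h1.congr' ?_
    filter_upwards [hgood] with N ⟨h1, h2, h3, h4, h5⟩
    have e1 : (k N - K N) ^ 2 = y N ^ 2 * (K N / c ^ 2) := by
      simp only [hy, hK]
      field_simp
    rw [e1, h5]
    congr 3
    field_simp
  have hcos : Tendsto (fun N => (cos (π / k N) * exp ((π / k N) ^ 2 / 2)) ^ (2 * N)) atTop (𝓝 1) := by
    have h1 : Tendsto (fun N => exp (-(π ^ 4 / c ^ 8 * ((x N ^ 4)⁻¹ * ((sixthRoot N)⁻¹) ^ 2))))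
        atTop (𝓝 1) := by
      have h2 : Tendsto (fun N => -(π ^ 4 / c ^ 8 * ((x N ^ 4)⁻¹ * ((sixthRoot N)⁻¹) ^ 2))) atTop
          (𝓝 (-(π ^ 4 / c ^ 8 * ((1 ^ 4)⁻¹ * 0 ^ 2)))) :=
        ((((hx1.pow 4).inv₀ (by norm_num)).mul (hsi.pow 2)).const_mul _).neg
      simpa [Function.comp_def] using (continuous_exp.tendsto _).comp h2
    refine tendsto_of_tendsto_of_tendsto_of_le_of_le' h1 tendsto_const_nhds ?_ ?_
    · filter_upwards [hgood] with N ⟨h1, h2, h3, h4, h5⟩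
      have h4' : (4 : ℝ) ≤ k N := by exact_mod_cast h4
      have h6 : π / k N ≤ 1 := by
        rw [div_le_one (by linarith)]
        exact pi_le_four.trans h4'
      have h7 : 0 ≤ π / k N := by positivity
      refine le_trans (le_of_eq ?_) (pow_le_pow_left₀ (exp_pos _).le
        (one_le_cos_mul_exp_sq (x := π / k N) (pow_le_one₀ h7 h6)) (2 * N))
      rw [← exp_nat_mul, h5]
      congr 1
      push_cast
      rw [← sixthRoot_pow N]
      simp only [hK]
      field_simp
    · filter_upwards [hgood] with N ⟨h1, h2, h3, h4, h5⟩
      exact (cosFactor_nonneg_le_one (by omega) _).2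
  have hpow : Tendsto (fun N => (K N / k N) ^ α) atTop (𝓝 1) := by
    have h1 : Tendsto (fun N => ((x N)⁻¹) ^ α) atTop (𝓝 1) := by
      simpa using (hx1.inv₀ one_ne_zero).pow α
    refine h1.congr' ?_
    filter_upwards [hgood] with N ⟨h1, h2, h3, h4, h5⟩
    rw [h5]
    congr 1
    field_simp
  have := (hΛ.comp hktop).mul ((hpow.mul hexp).mul hcos)
  rw [one_mul, mul_one] at this
  exact this

theorem laplace_sum_tendsto {l : ℝ} (hl : 0 < l) {d : ℕ → ℝ} {D : ℝ} (hD : ∀ k, |d k| ≤ D)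
    (hd : ∀ k < 2, d k = 0) {Λ : ℝ} (hΛ : Tendsto d atTop (𝓝 Λ)) (α : ℕ) {c : ℝ} (hc : 0 < c)
    (hcl : c ^ 6 * l = 2 * π ^ 2) :
    Tendsto (fun N : ℕ => (∑' k : ℕ, d k * (k : ℝ)⁻¹ ^ α * exp (-(l * k)) * cos (π / k) ^ (2 * N)) *
      (((c * sixthRoot N) ^ 2) ^ α * exp (3 / 2 * l * (c * sixthRoot N) ^ 2)) / sixthRoot N) atTop
      (𝓝 (Λ * √(π / (3 * l / (2 * c ^ 2))))) := by
  set bound : ℝ → ℝ := fun v =>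
    D * (α.factorial / l ^ α * exp (3 / 2 * l)) * exp l * exp (-(l / (2 * c) * |v|)) with hbound
  have hbi : Integrable bound := (integrable_exp_neg_mul_abs (by positivity)).const_mul _
  have hmeas : ∀ N : ℕ, AEStronglyMeasurable (fun v : ℝ => laplaceTerm l d α N
      ((c * sixthRoot N) ^ 2) ⌊(c * sixthRoot N) ^ 2 + sixthRoot N * v⌋₊) volume := by
    intro N
    refine Measurable.aestronglyMeasurable ?_
    exact (measurable_from_nat (f := laplaceTerm l d α N ((c * sixthRoot N) ^ 2))).comp
      (Nat.measurable_floor.comp (by fun_prop))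
  have hgood : ∀ᶠ N in atTop, 0 < sixthRoot N ∧ 1 ≤ (c * sixthRoot N) ^ 2 := by
    filter_upwards [tendsto_sixthRoot.eventually_gt_atTop 0,
      ((tendsto_pow_atTop two_ne_zero).comp
        (tendsto_sixthRoot.const_mul_atTop hc)).eventually_ge_atTop 1] with N h1 h2
    exact ⟨h1, h2⟩
  have hle : ∀ N : ℕ, 0 < sixthRoot N ∧ 1 ≤ (c * sixthRoot N) ^ 2 → ∀ v : ℝ,
      ‖laplaceTerm l d α N ((c * sixthRoot N) ^ 2)
        ⌊(c * sixthRoot N) ^ 2 + sixthRoot N * v⌋₊‖ ≤ bound v := by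
    intro N hN v
    rw [norm_eq_abs]
    exact abs_laplaceTerm_le hl hD hd α N hN.2 hN.1 hc rfl
  have hlim := tendsto_integral_filter_of_dominated_convergence bound
    (Eventually.of_forall hmeas) (hgood.mono fun N hN => Eventually.of_forall (hle N hN)) hbi
    (Eventually.of_forall fun v => tendsto_laplaceTerm (l := l) hΛ α hc v)
  rw [integral_const_mul, integral_gaussian] at hlim
  refine hlim.congr' ?_
  filter_upwards [hgood] with N hN
  have hint : Integrable fun v : ℝ => laplaceTerm l d α N ((c * sixthRoot N) ^ 2)
      ⌊(c * sixthRoot N) ^ 2 + sixthRoot N * v⌋₊ :=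
    hbi.mono' (hmeas N) (Eventually.of_forall (hle N hN))
  have hsum := hasSum_inv_mul_of_integrable_floor
    (by rw [laplaceTerm, hd 0 (by norm_num), zero_mul]) _ hN.1 hint
  rw [← hsum.tsum_eq, tsum_mul_left, ← tsum_mul_right, div_eq_inv_mul]
  congr 1
  refine tsum_congr fun k => ?_
  rcases Nat.eq_zero_or_pos k with rfl | hk
  · rw [laplaceTerm, hd 0 (by norm_num)]
    ring
  · rw [laplaceTerm_eq d α N _ hk.ne']
    rw [← sixthRoot_pow N]
    linear_combination sixthRoot N ^ 6 * hcl

end Laplace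

end DiestelLeader

namespace DiestelLeader

section Reduction

open Real Filter Topology Finset

theorem abs_cos_le_exp {k j : ℕ} (h2 : 2 ≤ j) (hj : j + 2 ≤ k) :
    |cos (π * j / k)| ≤ exp (-(2 * π ^ 2 / k ^ 2)) := by
  have hk : (0 : ℝ) < k := Nat.cast_pos.2 (by omega)
  have h2' : (2 : ℝ) ≤ j := by exact_mod_cast h2
  have hj' : (j : ℝ) + 2 ≤ k := by exact_mod_cast hj
  have e0 : 0 ≤ 2 * π / k := by positivity
  have e1 : 2 * π / k ≤ π * j / k := by
    gcongr ?_ / _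
    nlinarith [pi_pos]
  have e2 : π * j / k ≤ π - 2 * π / k := by
    rw [le_sub_iff_add_le, ← add_div, div_le_iff₀ hk]
    nlinarith [pi_pos]
  have e3 : 2 * π / k ≤ π / 2 := by
    rw [div_le_iff₀ hk]
    nlinarith [pi_pos]
  have hle : |cos (π * j / k)| ≤ cos (2 * π / k) := by
    refine abs_le.2 ⟨?_, cos_le_cos_of_nonneg_of_le_pi e0 (by linarith) e1⟩
    rw [← cos_pi_sub]
    exact cos_le_cos_of_nonneg_of_le_pi (by linarith) (by linarith) e2
  have := cos_mul_exp_sq_le_one e0 e3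
  rw [← le_div_iff₀ (exp_pos _), one_div, ← exp_neg] at this
  refine hle.trans (this.trans (le_of_eq ?_))
  congr 1
  field_simp

theorem sum_range_two_mul_of_symm {k : ℕ} (hk : 3 ≤ k) {f : ℕ → ℝ} (h0 : f 0 = 0)
    (hper : ∀ j, f (k + j) = f j) (hsymm : f (k - 1) = f 1) :
    ∑ j ∈ range (2 * k), f j = 4 * f 1 + 2 * ∑ j ∈ Ico 2 (k - 1), f j := by
  have h1 : ∑ j ∈ range k, f j = 2 * f 1 + ∑ j ∈ Ico 2 (k - 1), f j := by
    obtain ⟨m, rfl⟩ : ∃ m, k = m + 1 := ⟨k - 1, by omega⟩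
    rw [sum_range_succ, Nat.add_sub_cancel] at *
    rw [hsymm, ← sum_range_add_sum_Ico _ (show 2 ≤ m by omega), sum_range_succ, sum_range_one, h0]
    ring
  rw [two_mul, sum_range_add, sum_congr rfl fun j _ => hper j, h1]
  ring

theorem abs_sum_cos_pow_mul_sin_sq_sub_le {k : ℕ} (hk : 2 ≤ k) {N : ℕ} (hN : N ≠ 0) (m : ℕ) :
    |∑ j ∈ range (2 * k), cos (π * j / k) ^ (2 * N) * sin (π * j / k * m) ^ 2 -
      4 * (cos (π / k) ^ (2 * N) * sin (π / k * m) ^ 2)| ≤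
      2 * k * exp (-(4 * π ^ 2 * N / k ^ 2)) := by
  have hk0 : (k : ℝ) ≠ 0 := Nat.cast_ne_zero.2 (by omega)
  set f : ℕ → ℝ := fun j => cos (π * j / k) ^ (2 * N) * sin (π * j / k * m) ^ 2 with hf
  have hf1 : cos (π / k) ^ (2 * N) * sin (π / k * m) ^ 2 = f 1 := by simp [hf]
  have hsq : ∀ (θ : ℝ) (n : ℕ), sin (θ + n * π) ^ 2 = sin θ ^ 2 := by
    intro θ n
    rw [sin_add_nat_mul_pi, mul_pow, ← pow_mul, mul_comm n, pow_mul]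
    norm_num
  have hper : ∀ j, f (k + j) = f j := by
    intro j
    have e1 : π * ((k + j : ℕ) : ℝ) / k = π * j / k + π := by
      push_cast
      field_simp
      ring
    have e2 : (π * j / k + π) * m = π * j / k * m + m * π := by ring
    simp only [hf]
    rw [e1, e2, hsq, cos_add_pi, neg_pow, pow_mul]
    norm_num
  rw [hf1]
  rcases hk.eq_or_lt with rfl | hk3
  · have h0 : f 0 = 0 := by simp [hf]
    have h1 : f 1 = 0 := by simp [hf, hN]
    have h2 : f 2 = 0 := (hper 0).trans h0
    have h3 : f 3 = 0 := (hper 1).trans h1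
    simp only [sum_range_succ, sum_range_zero, h0, h1, h2, h3]
    norm_num
    positivity
  have hsymm : f (k - 1) = f 1 := by
    have e1 : π * ((k - 1 : ℕ) : ℝ) / k = π - π / k := by
      rw [Nat.cast_sub (by omega)]
      push_cast
      field_simp
    have e2 : (π - π / k) * m = -(π / k * m) + m * π := by ring
    simp only [hf]
    rw [e1, e2, hsq, cos_pi_sub, sin_neg, neg_sq, neg_pow, pow_mul]
    norm_num
  rw [sum_range_two_mul_of_symm hk3 (by simp [hf]) hper hsymm, add_sub_cancel_left,
    abs_mul, abs_two, mul_assoc]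
  refine mul_le_mul_of_nonneg_left ?_ zero_le_two
  refine (abs_sum_le_sum_abs _ _).trans ?_
  have hb : ∀ j ∈ Ico 2 (k - 1), |f j| ≤ exp (-(4 * π ^ 2 * N / k ^ 2)) := by
    intro j hj
    rw [mem_Ico] at hj
    have h1 := abs_cos_le_exp (k := k) hj.1 (by omega)
    simp only [hf]
    rw [abs_mul, abs_pow, abs_of_nonneg (sq_nonneg (sin _))]
    calc _ ≤ exp (-(2 * π ^ 2 / k ^ 2)) ^ (2 * N) * 1 :=
          mul_le_mul (pow_le_pow_left₀ (abs_nonneg _) h1 _) (sin_sq_le_one _) (sq_nonneg _)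
            (by positivity)
      _ = _ := by
          rw [mul_one, ← exp_nat_mul]
          congr 1
          push_cast
          ring
  refine (sum_le_card_nsmul _ _ _ hb).trans ?_
  rw [nsmul_eq_mul, Nat.card_Ico]
  gcongr
  omega

/-- The sum over `j` of `x ^ j * sin (π (j + 1) / k) ^ 2`, `0 ≤ j < k - 1`. -/
noncomputable def sinSum (x : ℝ) (k : ℕ) : ℝ :=
  ∑ j ∈ range (k - 1), x ^ j * sin (π * (j + 1 : ℕ) / k) ^ 2

variable {q r : ℕ}

theorem sum_antidiagonal_sin_sq (hq : 2 ≤ q) (hr : 2 ≤ r) (n : ℕ) :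
    ∑ p ∈ antidiagonal n, (q : ℝ)⁻¹ ^ p.1 * (r : ℝ)⁻¹ ^ p.2 *
      sin (π / (n + 2 : ℕ) * (p.1 + 1 : ℕ)) ^ 2 =
      (q : ℝ)⁻¹ ^ n * sinSum (q / r) (n + 2) := by
  have hq0 : (q : ℝ) ≠ 0 := Nat.cast_ne_zero.2 (by omega)
  have hr0 : (r : ℝ) ≠ 0 := Nat.cast_ne_zero.2 (by omega)
  rw [← Finset.Nat.sum_antidiagonal_swap, Finset.Nat.sum_antidiagonal_eq_sum_range_succ_mk, sinSum, mul_sum]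
  refine sum_congr rfl fun j hj => ?_
  have hj' : j ≤ n := by
    rw [mem_range] at hj
    omega
  have e1 : π / (n + 2 : ℕ) * ((n - j + 1 : ℕ) : ℝ) = π - π * (j + 1 : ℕ) / (n + 2 : ℕ) := by
    have : ((n : ℝ) + 2) ≠ 0 := by positivity
    push_cast [Nat.cast_sub hj']
    field_simp
    ring
  have e2 : (q : ℝ)⁻¹ ^ (n - j) = (q : ℝ)⁻¹ ^ n * q ^ j := by
    rw [inv_pow, inv_pow, pow_sub₀ _ hq0 hj', mul_inv, inv_inv]
  simp only [Prod.fst_swap, Prod.snd_swap]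
  rw [e1, sin_pi_sub, e2, div_pow, inv_pow, inv_pow]
  ring

theorem sum_antidiagonal_inv_pow_le (hq : 2 ≤ q) (hqr : q ≤ r) (n : ℕ) :
    ∑ p ∈ antidiagonal n, (q : ℝ)⁻¹ ^ p.1 * (r : ℝ)⁻¹ ^ p.2 ≤ (n + 1) * (q : ℝ)⁻¹ ^ n := by
  have hq0 : (0 : ℝ) < q := Nat.cast_pos.2 (by omega)
  have hle : (r : ℝ)⁻¹ ≤ (q : ℝ)⁻¹ := by
    gcongr
  have : ∀ p ∈ antidiagonal n, (q : ℝ)⁻¹ ^ p.1 * (r : ℝ)⁻¹ ^ p.2 ≤ (q : ℝ)⁻¹ ^ n := by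
    intro p hp
    rw [HasAntidiagonal.mem_antidiagonal] at hp
    rw [← hp, pow_add]
    gcongr
  refine (sum_le_card_nsmul _ _ _ this).trans ?_
  rw [nsmul_eq_mul, Nat.card_antidiagonal]
  push_cast
  exact le_rfl

/-- The coefficients in the Laplace sum for the leading eigenvalues. -/
noncomputable def dlCoeff (q r α k : ℕ) : ℝ :=
  if k < 2 then 0 else (1 - (q : ℝ)⁻¹) * (1 - (r : ℝ)⁻¹) * (4 / k) * q ^ 2 * k ^ α * sinSum (q / r) k

theorem inv_pow_mul_exp_le (hq : 2 ≤ q) {N : ℕ} {K : ℝ} (hK : 0 < K)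
    (hKN : K ^ 3 * log q = 2 * π ^ 2 * N) (n : ℕ) :
    (q : ℝ)⁻¹ ^ n * exp (-(4 * π ^ 2 * N / (n + 2 : ℕ) ^ 2)) ≤
      q ^ 2 * exp (-(9 / 5 * log q * K)) * exp (-(log q / 4)) ^ n := by
  have hq0 : (0 : ℝ) < q := Nat.cast_pos.2 (by omega)
  have hl : 0 < log q := log_pos (by exact_mod_cast (by omega : 1 < q))
  have e1 : (q : ℝ)⁻¹ ^ n = exp (-(log q * n)) := by
    rw [mul_comm, ← mul_neg, exp_nat_mul, exp_neg, exp_log hq0]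
  have e2 : (q : ℝ) ^ 2 = exp (2 * log q) := by
    have := exp_nat_mul (log q) 2
    rw [exp_log hq0] at this
    rw [← this]
    norm_num
  rw [e1, e2, ← exp_nat_mul, ← exp_add, ← exp_add, ← exp_add, exp_le_exp]
  set k : ℝ := ((n + 2 : ℕ) : ℝ) with hk
  have hn : (n : ℝ) = k - 2 := by rw [hk]; push_cast; ring
  have hk0 : 0 < k := by rw [hk]; positivity
  have e3 : 4 * π ^ 2 * N / k ^ 2 = log q * (2 * K ^ 3 / k ^ 2) := by
    field_simp
    linear_combination (-2 : ℝ) * hKN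
  have e4 : 9 / 5 * K ≤ 3 / 4 * k + 2 * K ^ 3 / k ^ 2 := by
    rw [← sub_le_iff_le_add', le_div_iff₀ (by positivity)]
    nlinarith [mul_nonneg (sq_nonneg (k - 8 / 5 * K)) (by positivity : 0 ≤ k + 4 / 5 * K),
      pow_pos hK 3]
  rw [e3, hn]
  nlinarith [mul_le_mul_of_nonneg_left e4 hl.le]

theorem summable_succ_mul_exp (hq : 2 ≤ q) :
    Summable fun n : ℕ => ((n : ℝ) + 1) * exp (-(log q / 4)) ^ n := by
  have hl : 0 < log q := log_pos (by exact_mod_cast (by omega : 1 < q))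
  have hx : ‖exp (-(log q / 4))‖ < 1 := by
    rw [norm_of_nonneg (exp_pos _).le, exp_lt_one_iff]
    linarith
  have h1 := summable_pow_mul_geometric_of_norm_lt_one 1 hx
  have h2 := summable_geometric_of_norm_lt_one hx
  refine (h1.add h2).congr fun n => ?_
  ring

theorem hasSum_sum_antidiagonal {f : ℕ × ℕ → ℝ} {a : ℝ} (hf : HasSum f a) :
    HasSum (fun n => ∑ p ∈ antidiagonal n, f p) a := by
  have h0 : HasSum (fun x : (Σ n : ℕ, antidiagonal n) => f x.2) a :=
    HasAntidiagonal.sigmaAntidiagonalEquivProd.hasSum_iff.2 hf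
  refine (h0.sigma fun n => hasSum_fintype _).congr_fun fun n => ?_
  exact (sum_coe_sort _ _).symm

theorem abs_sub_dlCoeff_sum_le (hq : 2 ≤ q) (hqr : q ≤ r) (α : ℕ) {N : ℕ} (hN : N ≠ 0) {K : ℝ}
    (hK : 0 < K) (hKN : K ^ 3 * log q = 2 * π ^ 2 * N) {P : ℝ}
    (hP : HasSum (fun p : ℕ × ℕ => ((q : ℝ)⁻¹ ^ p.1 * (1 - (q : ℝ)⁻¹)) *
        ((r : ℝ)⁻¹ ^ p.2 * (1 - (r : ℝ)⁻¹)) *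
        (((p.1 + p.2 + 2 : ℕ) : ℝ)⁻¹ * ∑ j ∈ range (2 * (p.1 + p.2 + 2)),
          (rhoDL q r * cos (π * j / (p.1 + p.2 + 2 : ℕ))) ^ (2 * N) *
            sin (π * j / (p.1 + p.2 + 2 : ℕ) * (p.1 + 1 : ℕ)) ^ 2)) P) :
    |P / rhoDL q r ^ (2 * N) - ∑' k : ℕ, dlCoeff q r α k * (k : ℝ)⁻¹ ^ α * exp (-(log q * k)) *
      cos (π / k) ^ (2 * N)| ≤
      (2 * q ^ 2 * ∑' n : ℕ, ((n : ℝ) + 1) * exp (-(log q / 4)) ^ n) *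
        exp (-(9 / 5 * log q * K)) := by
  have hr : 2 ≤ r := hq.trans hqr
  have hq0 : (0 : ℝ) < q := Nat.cast_pos.2 (by omega)
  have hr0 : (0 : ℝ) < r := Nat.cast_pos.2 (by omega)
  have hρ : 0 < rhoDL q r := by unfold rhoDL; positivity
  set w : ℝ := (1 - (q : ℝ)⁻¹) * (1 - (r : ℝ)⁻¹) with hw
  have hqi : (q : ℝ)⁻¹ ≤ 1 := inv_le_one_of_one_le₀ (by exact_mod_cast (by omega : 1 ≤ q))
  have hri : (r : ℝ)⁻¹ ≤ 1 := inv_le_one_of_one_le₀ (by exact_mod_cast (by omega : 1 ≤ r))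
  have hqi0 : 0 < (q : ℝ)⁻¹ := by positivity
  have hri0 : 0 < (r : ℝ)⁻¹ := by positivity
  have hw0 : 0 ≤ w := mul_nonneg (by linarith) (by linarith)
  have hw1 : w ≤ 1 := mul_le_one₀ (by linarith) (by linarith) (by linarith)
  set S : ℕ → ℕ → ℝ := fun n m => ∑ j ∈ range (2 * (n + 2)),
    cos (π * j / (n + 2 : ℕ)) ^ (2 * N) * sin (π * j / (n + 2 : ℕ) * m) ^ 2 with hS
  set E : ℕ → ℝ := fun n => ∑ p ∈ antidiagonal n, (q : ℝ)⁻¹ ^ p.1 * (r : ℝ)⁻¹ ^ p.2 *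
    (w * ((n + 2 : ℕ) : ℝ)⁻¹ * S n (p.1 + 1)) with hE
  have hEsum : HasSum E (P / rhoDL q r ^ (2 * N)) := by
    refine (hasSum_sum_antidiagonal (hP.div_const (rhoDL q r ^ (2 * N)))).congr_fun fun n => ?_
    rw [hE]
    refine sum_congr rfl fun p hp => ?_
    rw [HasAntidiagonal.mem_antidiagonal] at hp
    rw [hp, hS]
    simp only [mul_pow, mul_assoc]
    rw [← mul_sum, hw]
    rw [eq_div_iff (pow_pos hρ (2 * N)).ne']
    ring
  set M : ℕ → ℝ := fun n => dlCoeff q r α (n + 2) * ((n + 2 : ℕ) : ℝ)⁻¹ ^ α *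
    exp (-(log q * (n + 2 : ℕ))) * cos (π / (n + 2 : ℕ)) ^ (2 * N) with hM
  have hM' : ∀ n, M n = ∑ p ∈ antidiagonal n, (q : ℝ)⁻¹ ^ p.1 * (r : ℝ)⁻¹ ^ p.2 *
      (w * ((n + 2 : ℕ) : ℝ)⁻¹ * (4 * (cos (π / (n + 2 : ℕ)) ^ (2 * N) *
        sin (π / (n + 2 : ℕ) * (p.1 + 1 : ℕ)) ^ 2))) := by
    intro n
    have e1 : exp (-(log q * (n + 2 : ℕ))) = (q : ℝ)⁻¹ ^ (n + 2) := by
      rw [mul_comm, ← mul_neg, exp_nat_mul, exp_neg, exp_log hq0]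
    have hk0 : ((n + 2 : ℕ) : ℝ) ≠ 0 := Nat.cast_ne_zero.2 (by omega)
    have e2 := sum_antidiagonal_sin_sq hq hr n
    have e3 : ∀ p ∈ antidiagonal n, (q : ℝ)⁻¹ ^ p.1 * (r : ℝ)⁻¹ ^ p.2 *
      (w * ((n + 2 : ℕ) : ℝ)⁻¹ * (4 * (cos (π / (n + 2 : ℕ)) ^ (2 * N) *
        sin (π / (n + 2 : ℕ) * (p.1 + 1 : ℕ)) ^ 2))) = w * ((n + 2 : ℕ) : ℝ)⁻¹ * 4 *
        cos (π / (n + 2 : ℕ)) ^ (2 * N) * ((q : ℝ)⁻¹ ^ p.1 * (r : ℝ)⁻¹ ^ p.2 *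
          sin (π / (n + 2 : ℕ) * (p.1 + 1 : ℕ)) ^ 2) := fun p _ => by ring
    rw [sum_congr rfl e3, ← mul_sum, e2]
    simp only [hM]
    rw [dlCoeff, if_neg (by omega), e1, ← hw, pow_add (q : ℝ)⁻¹]
    generalize ((n + 2 : ℕ) : ℝ) = k at *
    rw [inv_pow k, inv_pow (q : ℝ) 2]
    field_simp
  have hdiff : ∀ n, |E n - M n| ≤ 2 * q ^ 2 * exp (-(9 / 5 * log q * K)) *
      (((n : ℝ) + 1) * exp (-(log q / 4)) ^ n) := by
    intro n
    have hk0 : (0 : ℝ) < ((n + 2 : ℕ) : ℝ) := Nat.cast_pos.2 (by omega)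
    rw [hM', hE, ← sum_sub_distrib]
    calc _ ≤ ∑ p ∈ antidiagonal n, (q : ℝ)⁻¹ ^ p.1 * (r : ℝ)⁻¹ ^ p.2 *
          (2 * exp (-(4 * π ^ 2 * N / (n + 2 : ℕ) ^ 2))) := by
          refine (abs_sum_le_sum_abs _ _).trans (sum_le_sum fun p _ => ?_)
          rw [← mul_sub, ← mul_sub, abs_mul,
            abs_of_nonneg (a := (q : ℝ)⁻¹ ^ p.1 * (r : ℝ)⁻¹ ^ p.2) (by positivity), abs_mul,
            abs_of_nonneg (a := w * ((n + 2 : ℕ) : ℝ)⁻¹) (by positivity)]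
          refine mul_le_mul_of_nonneg_left ?_ (by positivity)
          have := abs_sum_cos_pow_mul_sin_sq_sub_le (k := n + 2) (by omega) hN (p.1 + 1)
          calc _ ≤ w * ((n + 2 : ℕ) : ℝ)⁻¹ *
                (2 * (n + 2 : ℕ) * exp (-(4 * π ^ 2 * N / (n + 2 : ℕ) ^ 2))) :=
                mul_le_mul_of_nonneg_left this (by positivity)
            _ = w * (2 * exp (-(4 * π ^ 2 * N / (n + 2 : ℕ) ^ 2))) := by field_simp
            _ ≤ _ := mul_le_of_le_one_left (by positivity) hw1
      _ ≤ ((n + 1) * (q : ℝ)⁻¹ ^ n) * (2 * exp (-(4 * π ^ 2 * N / (n + 2 : ℕ) ^ 2))) := by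
          rw [← sum_mul]
          gcongr
          exact sum_antidiagonal_inv_pow_le hq hqr n
      _ = 2 * (n + 1) * ((q : ℝ)⁻¹ ^ n * exp (-(4 * π ^ 2 * N / (n + 2 : ℕ) ^ 2))) := by ring
      _ ≤ 2 * (n + 1) * (q ^ 2 * exp (-(9 / 5 * log q * K)) * exp (-(log q / 4)) ^ n) :=
          mul_le_mul_of_nonneg_left (inv_pow_mul_exp_le hq hK hKN n) (by positivity)
      _ = _ := by ring
  have hbs := (summable_succ_mul_exp hq).mul_left (2 * q ^ 2 * exp (-(9 / 5 * log q * K)))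
  have hds : Summable fun n => E n - M n := Summable.of_norm_bounded hbs hdiff
  have hMs : Summable M := by
    have := hEsum.summable.sub hds
    simpa using this
  have hshift : ∑' k : ℕ, dlCoeff q r α k * (k : ℝ)⁻¹ ^ α * exp (-(log q * k)) *
      cos (π / k) ^ (2 * N) = ∑' n, M n := by
    refine ((add_left_injective 2).tsum_eq ?_).symm
    intro k hk
    by_contra h
    refine hk ?_
    have hk2 : k < 2 := by
      by_contra! h2
      exact h ⟨k - 2, by simp only; omega⟩
    simp [dlCoeff, hk2]
  rw [hshift, ← hEsum.tsum_eq, ← hEsum.summable.tsum_sub hMs]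
  refine (tsum_of_norm_bounded (f := fun n => E n - M n) hbs.hasSum hdiff).trans (le_of_eq ?_)
  rw [tsum_mul_left]
  ring

end Reduction

end DiestelLeader

namespace DiestelLeader

section Coefficients

open Real Filter Topology Finset

theorem sinSum_one {k : ℕ} (hk : 2 ≤ k) : sinSum 1 k = k / 2 := by
  have hk0 : (k : ℝ) ≠ 0 := Nat.cast_ne_zero.2 (by omega)
  have h1 := sum_sin_mul_sin k 1 1 one_pos (by omega) one_pos (by omega)
  simp only [Int.cast_one, mul_one, if_true, ← sq] at h1
  have hper : ∀ j : ℕ, sin (π * ((k + j : ℕ) : ℝ) / k) ^ 2 = sin (π * j / k) ^ 2 := by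
    intro j
    have e1 : π * ((k + j : ℕ) : ℝ) / k = π * j / k + π := by
      push_cast
      field_simp
      ring
    rw [e1, sin_add_pi, neg_sq]
  rw [two_mul, sum_range_add, sum_congr rfl fun j _ => hper j, ← two_mul] at h1
  obtain ⟨m, rfl⟩ : ∃ m, k = m + 1 := ⟨k - 1, by omega⟩
  rw [sum_range_succ'] at h1
  simp only [Nat.cast_zero, mul_zero, zero_div, sin_zero] at h1
  simp only [sinSum, one_pow, one_mul, Nat.add_sub_cancel]
  linarith

theorem hasSum_sq_mul_geometric {x : ℝ} (hx0 : 0 ≤ x) (hx1 : x < 1) :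
    HasSum (fun j : ℕ => x ^ j * ((j + 1 : ℕ) : ℝ) ^ 2) ((1 + x) / (1 - x) ^ 3) := by
  have hx : ‖x‖ < 1 := by rwa [norm_of_nonneg hx0]
  have h1 := hasSum_choose_mul_geometric_of_norm_lt_one 1 hx
  have h2 := hasSum_choose_mul_geometric_of_norm_lt_one 2 hx
  have h3 := (h2.mul_left 2).sub h1
  have hne : 1 - x ≠ 0 := by linarith
  have e : 2 * (1 / (1 - x) ^ (2 + 1)) - 1 / (1 - x) ^ (1 + 1) = (1 + x) / (1 - x) ^ 3 := by
    field_simp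
    ring
  rw [e] at h3
  refine h3.congr_fun fun j => ?_
  rw [Nat.choose_one_right, Nat.cast_choose_two]
  push_cast
  ring

theorem tendsto_sq_mul_sinSum {x : ℝ} (hx0 : 0 ≤ x) (hx1 : x < 1) :
    Tendsto (fun k : ℕ => (k : ℝ) ^ 2 * sinSum x k) atTop (𝓝 (π ^ 2 * ((1 + x) / (1 - x) ^ 3))) := by
  have hsum := (hasSum_sq_mul_geometric hx0 hx1).mul_left (π ^ 2)
  rw [← hsum.tsum_eq]
  set f : ℕ → ℕ → ℝ := fun k j =>
    if j < k - 1 then x ^ j * (k * sin (π * (j + 1 : ℕ) / k)) ^ 2 else 0 with hf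
  have hlim : Tendsto (fun k => ∑' j, f k j) atTop
      (𝓝 (∑' j : ℕ, π ^ 2 * (x ^ j * ((j + 1 : ℕ) : ℝ) ^ 2))) := by
    refine tendsto_tsum_of_dominated_convergence hsum.summable (fun j => ?_)
      (Eventually.of_forall fun k j => ?_)
    · have h1 : Tendsto (fun k : ℕ => x ^ j * (π * (j + 1 : ℕ) * sinc (π * (j + 1 : ℕ) / k)) ^ 2)
          atTop (𝓝 (x ^ j * (π * (j + 1 : ℕ) * 1) ^ 2)) := by
        refine Tendsto.const_mul _ (Tendsto.pow (Tendsto.const_mul _ ?_) 2)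
        have h2 := (continuous_sinc.tendsto 0).comp
          (tendsto_const_div_atTop_nhds_zero_nat (π * (j + 1 : ℕ)))
        rwa [sinc_zero] at h2
      have e : π ^ 2 * (x ^ j * ((j + 1 : ℕ) : ℝ) ^ 2) = x ^ j * (π * (j + 1 : ℕ) * 1) ^ 2 := by ring
      rw [e]
      refine h1.congr' ?_
      filter_upwards [eventually_gt_atTop (j + 1)] with k hk
      have hk0 : (k : ℝ) ≠ 0 := Nat.cast_ne_zero.2 (by omega)
      have hj0 : ((j + 1 : ℕ) : ℝ) ≠ 0 := Nat.cast_ne_zero.2 (by omega)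
      simp only [hf]
      rw [if_pos (by omega), sinc_of_ne_zero (by positivity)]
      field_simp
    · simp only [hf]
      split_ifs with h
      · have hk0 : (0 : ℝ) < k := Nat.cast_pos.2 (by omega)
        rw [norm_of_nonneg (by positivity)]
        have h1 : |k * sin (π * (j + 1 : ℕ) / k)| ≤ |π * (j + 1 : ℕ)| := by
          rw [abs_mul, abs_of_pos hk0]
          calc _ ≤ (k : ℝ) * |π * (j + 1 : ℕ) / k| :=
              mul_le_mul_of_nonneg_left abs_sin_le_abs hk0.le
            _ = _ := by
              rw [abs_div, abs_of_pos hk0]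
              field_simp
        have h2 := sq_le_sq.2 h1
        calc _ ≤ x ^ j * (π * (j + 1 : ℕ)) ^ 2 := by gcongr
          _ = _ := by ring
      · rw [norm_zero]
        positivity
  refine hlim.congr fun k => ?_
  rw [sinSum, mul_sum, tsum_eq_sum (s := range (k - 1))]
  · refine sum_congr rfl fun j hj => ?_
    simp only [hf]
    rw [if_pos (mem_range.1 hj)]
    ring
  · intro j hj
    rw [mem_range] at hj
    simp only [hf]
    rw [if_neg hj]

variable {q r : ℕ}

theorem tendsto_dlCoeff_of_lt (hq : 2 ≤ q) (hqr : q < r) :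
    Tendsto (dlCoeff q r 3) atTop (𝓝 (4 * π ^ 2 *
      ((q : ℝ) * r * (q + r) * (q - 1) * (r - 1)) / ((r : ℝ) - q) ^ 3)) := by
  have hq0 : (0 : ℝ) < q := Nat.cast_pos.2 (by omega)
  have hr0 : (0 : ℝ) < r := Nat.cast_pos.2 (by omega)
  have hqr' : (q : ℝ) < r := by exact_mod_cast hqr
  have h1 := (tendsto_sq_mul_sinSum (x := (q : ℝ) / r) (by positivity)
    ((div_lt_one hr0).2 hqr')).const_mul ((1 - (q : ℝ)⁻¹) * (1 - (r : ℝ)⁻¹) * 4 * q ^ 2)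
  have e : (1 - (q : ℝ)⁻¹) * (1 - (r : ℝ)⁻¹) * 4 * q ^ 2 *
      (π ^ 2 * ((1 + (q : ℝ) / r) / (1 - (q : ℝ) / r) ^ 3)) = 4 * π ^ 2 *
      ((q : ℝ) * r * (q + r) * (q - 1) * (r - 1)) / ((r : ℝ) - q) ^ 3 := by
    have h2 : (r : ℝ) - q ≠ 0 := by linarith
    have h3 : 1 - (q : ℝ) / r = (r - q) / r := by field_simp
    rw [h3]
    field_simp
    ring
  rw [e] at h1
  refine h1.congr' ?_
  filter_upwards [eventually_ge_atTop 2] with k hk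
  have hk0 : (k : ℝ) ≠ 0 := Nat.cast_ne_zero.2 (by omega)
  rw [dlCoeff, if_neg (by omega)]
  field_simp

theorem tendsto_dlCoeff_self (hq : 2 ≤ q) :
    Tendsto (dlCoeff q q 0) atTop (𝓝 (2 * ((q : ℝ) - 1) ^ 2)) := by
  have hq0 : (q : ℝ) ≠ 0 := Nat.cast_ne_zero.2 (by omega)
  refine tendsto_const_nhds.congr' ?_
  filter_upwards [eventually_ge_atTop 2] with k hk
  have hk0 : (k : ℝ) ≠ 0 := Nat.cast_ne_zero.2 (by omega)
  rw [dlCoeff, if_neg (by omega), div_self hq0, sinSum_one hk]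
  field_simp
  ring

end Coefficients

section Constants

open Real

variable {q : ℕ}

theorem log_natCast_pos (hq : 2 ≤ q) : 0 < log q := log_pos (by exact_mod_cast (by omega : 1 < q))

theorem rpow_div_three_pow {x : ℝ} (hx : 0 ≤ x) (m : ℕ) : (x ^ ((m : ℝ) / 3)) ^ 3 = x ^ m := by
  rw [← rpow_natCast, ← rpow_mul hx, ← rpow_natCast x m]
  norm_num

theorem xi₁_pos (hq : 2 ≤ q) : 0 < xi₁ q := by
  have := log_natCast_pos hq
  unfold xi₁
  positivity

theorem xi₁_pow (hq : 2 ≤ q) : xi₁ q ^ 3 = 2 * π ^ 2 / log q := by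
  have := log_natCast_pos hq
  simpa [xi₁] using rpow_div_three_pow (x := 2 * π ^ 2 / log q) (by positivity) 1

theorem B₁_eq (hq : 2 ≤ q) : B₁ q = 3 / 2 * log q * xi₁ q := by
  have hl := log_natCast_pos hq
  have hx := xi₁_pos hq
  have h0 : 0 ≤ B₁ q := by unfold B₁; positivity
  rw [← pow_left_inj₀ h0 (by positivity) three_ne_zero, mul_pow, xi₁_pow hq, B₁, mul_pow]
  have := rpow_div_three_pow (x := π * log q / 2) (by positivity) 2
  push_cast at this
  rw [this]
  field_simp

theorem C₁_eq (hq : 2 ≤ q) : C₁ q = 3 * log q / xi₁ q := by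
  have hl := log_natCast_pos hq
  have hx := xi₁_pos hq
  have h0 : 0 ≤ C₁ q := by unfold C₁; positivity
  rw [← pow_left_inj₀ h0 (by positivity) three_ne_zero, div_pow, xi₁_pow hq, C₁, mul_pow]
  have := rpow_div_three_pow (x := log q ^ 2 / (4 * π)) (by positivity) 2
  push_cast at this
  rw [this]
  field_simp
  norm_num

theorem sixthRoot_sq (N : ℕ) : sixthRoot N ^ 2 = (N : ℝ) ^ ((1 : ℝ) / 3) := by
  rw [sixthRoot, ← rpow_natCast, ← rpow_mul N.cast_nonneg]
  norm_num

end Constants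

section Asymptotics

open Real Filter Topology Finset

variable {q r : ℕ}

theorem tendsto_pow_mul_exp_sub_div_sixthRoot {l ξ : ℝ} (hl : 0 < l) (hξ : 0 < ξ) (α : ℕ) :
    Tendsto (fun N : ℕ => exp (-(9 / 5 * l * (ξ * sixthRoot N ^ 2))) *
      ((ξ * sixthRoot N ^ 2) ^ α * exp (3 / 2 * l * (ξ * sixthRoot N ^ 2))) / sixthRoot N)
      atTop (𝓝 0) := by
  have hs := tendsto_sixthRoot
  have h1 : Tendsto (fun N : ℕ => 3 / 10 * l * ξ * sixthRoot N ^ 2) atTop atTop :=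
    ((tendsto_pow_atTop two_ne_zero).comp hs).const_mul_atTop (by positivity)
  have h2 := ((tendsto_pow_mul_exp_neg_atTop_nhds_zero α).comp h1).mul
    (tendsto_inv_atTop_zero.comp hs)
  have h3 := h2.const_mul ((3 / 10 * l) ^ α)⁻¹
  simp only [mul_zero] at h3
  refine h3.congr fun N => ?_
  have e : exp (-(9 / 5 * l * (ξ * sixthRoot N ^ 2))) * exp (3 / 2 * l * (ξ * sixthRoot N ^ 2)) =
      exp (-(3 / 10 * l * ξ * sixthRoot N ^ 2)) := by
    rw [← exp_add]
    ring_nf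
  simp only [Function.comp_apply]
  have e3 : ∀ a b c d : ℝ, a * (b * c) / d = b * (a * c) / d := fun _ _ _ _ => by ring
  rw [e3, e]
  have e2 : 3 / 10 * l * ξ * sixthRoot N ^ 2 = 3 / 10 * l * (ξ * sixthRoot N ^ 2) := by ring
  rw [e2, mul_pow (3 / 10 * l)]
  have : (3 / 10 * l) ^ α ≠ 0 := by positivity
  field_simp

theorem tendsto_normalized (hq : 2 ≤ q) (hqr : q ≤ r) (α : ℕ) {Λ : ℝ}
    (hΛ : Tendsto (dlCoeff q r α) atTop (𝓝 Λ)) {P : ℕ → ℝ}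
    (hP : ∀ N, HasSum (fun p : ℕ × ℕ => ((q : ℝ)⁻¹ ^ p.1 * (1 - (q : ℝ)⁻¹)) *
        ((r : ℝ)⁻¹ ^ p.2 * (1 - (r : ℝ)⁻¹)) *
        (((p.1 + p.2 + 2 : ℕ) : ℝ)⁻¹ * ∑ j ∈ range (2 * (p.1 + p.2 + 2)),
          (rhoDL q r * cos (π * j / (p.1 + p.2 + 2 : ℕ))) ^ (2 * N) *
            sin (π * j / (p.1 + p.2 + 2 : ℕ) * (p.1 + 1 : ℕ)) ^ 2)) (P N)) :
    Tendsto (fun N : ℕ => P N / rhoDL q r ^ (2 * N) *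
      ((xi₁ q * sixthRoot N ^ 2) ^ α * exp (3 / 2 * log q * (xi₁ q * sixthRoot N ^ 2))) /
        sixthRoot N) atTop (𝓝 (Λ * √(2 * π / C₁ q))) := by
  have hl := log_natCast_pos hq
  have hξ := xi₁_pos hq
  obtain ⟨D, hD⟩ := (Metric.isBounded_range_of_tendsto _ hΛ).exists_norm_le
  have hc2 : √(xi₁ q) ^ 2 = xi₁ q := sq_sqrt hξ.le
  have hc6 : √(xi₁ q) ^ 6 * log q = 2 * π ^ 2 := by
    rw [show 6 = 2 * 3 by rfl, pow_mul, hc2, xi₁_pow hq]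
    field_simp
  have h1 := laplace_sum_tendsto hl (d := dlCoeff q r α) (fun k => hD _ ⟨k, rfl⟩)
    (fun k hk => if_pos hk) hΛ α (sqrt_pos.2 hξ) hc6
  have e1 : π / (3 * log q / (2 * √(xi₁ q) ^ 2)) = 2 * π / C₁ q := by
    rw [hc2, C₁_eq hq]
    field_simp
  simp only [mul_pow √(xi₁ q), hc2] at h1
  rw [← hc2, e1] at h1
  rw [hc2] at h1
  have h2 := (tendsto_pow_mul_exp_sub_div_sixthRoot hl hξ α).const_mul
    (2 * (q : ℝ) ^ 2 * ∑' n : ℕ, ((n : ℝ) + 1) * exp (-(log q / 4)) ^ n)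
  rw [mul_zero] at h2
  have h3 : Tendsto (fun N : ℕ => (P N / rhoDL q r ^ (2 * N) - ∑' k : ℕ, dlCoeff q r α k *
      (k : ℝ)⁻¹ ^ α * exp (-(log q * k)) * cos (π / k) ^ (2 * N)) *
      ((xi₁ q * sixthRoot N ^ 2) ^ α * exp (3 / 2 * log q * (xi₁ q * sixthRoot N ^ 2))) /
        sixthRoot N) atTop (𝓝 0) := by
    refine squeeze_zero_norm' ?_ h2
    filter_upwards [tendsto_sixthRoot.eventually_gt_atTop 0, eventually_ne_atTop 0] with N hs hN
    have h4 := abs_sub_dlCoeff_sum_le hq hqr α hN (K := xi₁ q * sixthRoot N ^ 2) (by positivity)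
      (by rw [mul_pow, xi₁_pow hq, ← pow_mul, sixthRoot_pow]; field_simp) (hP N)
    rw [norm_eq_abs, abs_div, abs_mul, abs_of_pos hs, abs_of_nonneg (by positivity :
      0 ≤ (xi₁ q * sixthRoot N ^ 2) ^ α * exp (3 / 2 * log q * (xi₁ q * sixthRoot N ^ 2)))]
    refine (div_le_div_of_nonneg_right (mul_le_mul_of_nonneg_right h4 (by positivity))
      hs.le).trans (le_of_eq ?_)
    ring
  have h5 := h3.add h1
  rw [zero_add] at h5
  refine h5.congr fun N => ?_
  ring

theorem isEquivalent_of_tendsto_normalized {u : ℕ → ℝ} {ρ l ξ L : ℝ} {α : ℕ} (hρ : 0 < ρ)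
    (hξ : 0 < ξ) (hL : L ≠ 0)
    (h : Tendsto (fun N : ℕ => u N / ρ ^ (2 * N) * ((ξ * sixthRoot N ^ 2) ^ α *
      exp (3 / 2 * l * (ξ * sixthRoot N ^ 2))) / sixthRoot N) atTop (𝓝 L)) :
    Asymptotics.IsEquivalent atTop u fun N => L * (ξ ^ α)⁻¹ * ρ ^ (2 * N) *
      exp (-(3 / 2 * l * ξ) * sixthRoot N ^ 2) * (sixthRoot N / sixthRoot N ^ (2 * α)) := by
  refine Asymptotics.isEquivalent_of_tendsto_one ?_
  have h1 := h.div_const L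
  rw [div_self hL] at h1
  refine h1.congr' ?_
  filter_upwards [tendsto_sixthRoot.eventually_gt_atTop 0] with N hs
  have e : exp (-(3 / 2 * l * ξ) * sixthRoot N ^ 2) =
      (exp (3 / 2 * l * (ξ * sixthRoot N ^ 2)))⁻¹ := by
    rw [← exp_neg]
    ring_nf
  have := (pow_pos hρ (2 * N)).ne'
  have := (exp_pos (3 / 2 * l * (ξ * sixthRoot N ^ 2))).ne'
  simp only [Pi.div_apply]
  rw [e, mul_pow, ← pow_mul]
  field_simp

theorem eventually_pow_le_of_tendsto_normalized {u : ℕ → ℝ} {ρ l ξ L : ℝ} {α : ℕ} (hρ : 0 < ρ)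
    (hξ : 0 < ξ) (hL : 0 < L)
    (h : Tendsto (fun N : ℕ => u N / ρ ^ (2 * N) * ((ξ * sixthRoot N ^ 2) ^ α *
      exp (3 / 2 * l * (ξ * sixthRoot N ^ 2))) / sixthRoot N) atTop (𝓝 L))
    (c : ℝ) (hc0 : 0 ≤ c) (hc : c < ρ) : ∀ᶠ N : ℕ in atTop, c ^ (2 * N) ≤ u N := by
  set x : ℝ := max c (ρ / 2) / ρ with hx
  have hx0 : 0 < x := by positivity
  have hx1 : x < 1 := (div_lt_one hρ).2 (max_lt hc (by linarith))
  have hlog : log x < 0 := log_neg hx0 hx1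
  have hs := tendsto_sixthRoot
  have h1 : Tendsto (fun N : ℕ => x ^ (2 * N) * ((ξ * sixthRoot N ^ 2) ^ α *
      exp (3 / 2 * l * (ξ * sixthRoot N ^ 2))) / sixthRoot N) atTop (𝓝 0) := by
    have h2 : Tendsto (fun N : ℕ => sixthRoot N ^ 2 * ((3 / 2 * l + 1) * ξ + 2 * log x *
        sixthRoot N ^ 4)) atTop atBot := by
      refine ((tendsto_pow_atTop two_ne_zero).comp hs).atTop_mul_atBot₀ ?_
      exact tendsto_atBot_add_const_left _ _
        (((tendsto_pow_atTop four_ne_zero).comp hs).const_mul_atTop_of_neg (by linarith))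
    have h3 := (tendsto_exp_atBot.comp h2).const_mul (α.factorial : ℝ)
    rw [mul_zero] at h3
    refine squeeze_zero' ?_ ?_ h3
    · filter_upwards [hs.eventually_gt_atTop 0] with N hN
      positivity
    · filter_upwards [hs.eventually_ge_atTop 1] with N hN
      have hs0 : 0 < sixthRoot N := by linarith
      have h4 := pow_div_factorial_le_exp (x := ξ * sixthRoot N ^ 2) (by positivity) α
      rw [div_le_iff₀ (by positivity)] at h4
      have h5 : x ^ (2 * N) = exp (2 * log x * sixthRoot N ^ 6) := by
        rw [sixthRoot_pow, ← exp_log hx0, ← exp_nat_mul, log_exp]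
        push_cast
        ring_nf
      refine (div_le_self (by positivity) hN).trans ?_
      calc _ ≤ x ^ (2 * N) * ((exp (ξ * sixthRoot N ^ 2) * α.factorial) *
            exp (3 / 2 * l * (ξ * sixthRoot N ^ 2))) := by gcongr
        _ = α.factorial * (x ^ (2 * N) * (exp (ξ * sixthRoot N ^ 2) *
            exp (3 / 2 * l * (ξ * sixthRoot N ^ 2)))) := by ring
        _ = _ := by
          rw [h5, ← exp_add, ← exp_add]
          simp only [Function.comp_apply]
          ring_nf
  have h6 : ∀ᶠ N : ℕ in atTop, x ^ (2 * N) * ((ξ * sixthRoot N ^ 2) ^ α *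
      exp (3 / 2 * l * (ξ * sixthRoot N ^ 2))) / sixthRoot N ≤ u N / ρ ^ (2 * N) *
        ((ξ * sixthRoot N ^ 2) ^ α * exp (3 / 2 * l * (ξ * sixthRoot N ^ 2))) / sixthRoot N :=
    (h1.eventually_lt h hL).mono fun N hN => hN.le
  filter_upwards [h6, hs.eventually_gt_atTop 0] with N hN hsN
  rw [div_le_div_iff_of_pos_right hsN, mul_le_mul_iff_left₀ (by positivity),
    le_div_iff₀ (by positivity), ← mul_pow, hx, div_mul_cancel₀ _ hρ.ne'] at hN
  exact (pow_le_pow_left₀ hc0 (le_max_left _ _) _).trans hN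

end Asymptotics

end DiestelLeader

theorem theorem5p2 {V₁ V₂ : Type*} (q r : ℕ) (hq : 2 ≤ q) (hr : 2 ≤ r)
    (T₁ : SimpleGraph V₁) [T₁.LocallyFinite] (hT₁ : T₁.IsTree)
    (hdeg₁ : T₁.IsRegularOfDegree (q + 1))
    (T₂ : SimpleGraph V₂) [T₂.LocallyFinite] (hT₂ : T₂.IsTree)
    (hdeg₂ : T₂.IsRegularOfDegree (r + 1))
    (o₁ : V₁) (o₂ : V₂)
    (ω₁ : ℕ → V₁) (hω₁ : DiestelLeader.IsGeodesicRay T₁ ω₁)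
    (ω₂ : ℕ → V₂) (hω₂ : DiestelLeader.IsGeodesicRay T₂ ω₂) :
    (q < r →
      ∃ P : lp (fun _ : DiestelLeader.DLVertex T₁ T₂ ω₁ ω₂ o₁ o₂ => ℂ) 2 →L[ℂ]
          lp (fun _ : DiestelLeader.DLVertex T₁ T₂ ω₁ ω₂ o₁ o₂ => ℂ) 2,
        DiestelLeader.IsSRWOperator (DiestelLeader.DLGraph T₁ T₂ ω₁ ω₂ o₁ o₂) P ∧
        (spectralRadius ℂ P).toReal = 2 * √((q : ℝ) * r) / ((q : ℝ) + r) ∧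
        Asymptotics.IsEquivalent Filter.atTop
          (fun N : ℕ => DiestelLeader.srwProb (DiestelLeader.DLGraph T₁ T₂ ω₁ ω₂ o₁ o₂) (2 * N)
            (DiestelLeader.DLRoot T₁ T₂ ω₁ ω₂ o₁ o₂) (DiestelLeader.DLRoot T₁ T₂ ω₁ ω₂ o₁ o₂))
          (fun N : ℕ => DiestelLeader.A₁ q r * (spectralRadius ℂ P).toReal ^ (2 * N) *
            Real.exp (-DiestelLeader.B₁ q * (N : ℝ) ^ ((1 : ℝ) / 3)) *
            (N : ℝ) ^ (-(5 : ℝ) / 6))) ∧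
    (r = q →
      Asymptotics.IsEquivalent Filter.atTop
        (fun N : ℕ => DiestelLeader.srwProb (DiestelLeader.DLGraph T₁ T₂ ω₁ ω₂ o₁ o₂) (2 * N)
          (DiestelLeader.DLRoot T₁ T₂ ω₁ ω₂ o₁ o₂) (DiestelLeader.DLRoot T₁ T₂ ω₁ ω₂ o₁ o₂))
        (fun N : ℕ => DiestelLeader.Abar₁ q *
          Real.exp (-DiestelLeader.B₁ q * (N : ℝ) ^ ((1 : ℝ) / 3)) *
          (N : ℝ) ^ ((1 : ℝ) / 6))) := by
  obtain ⟨par₁, ch₁, H₁⟩ := DiestelLeader.exists_isHoro hT₁ hdeg₁ hω₁ o₁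
  obtain ⟨par₂, ch₂, H₂⟩ := DiestelLeader.exists_isHoro hT₂ hdeg₂ hω₂ o₂
  have hsum := fun N : ℕ => DiestelLeader.hasSum_srwProb_root H₁ H₂ hq hr (2 * N)
  have hξ := DiestelLeader.xi₁_pos hq
  have hq0 : (0 : ℝ) < q := Nat.cast_pos.2 (by omega)
  have hr0 : (0 : ℝ) < r := Nat.cast_pos.2 (by omega)
  have hq1 : (0 : ℝ) < (q : ℝ) - 1 := sub_pos.2 (by exact_mod_cast (by omega : 1 < q))
  have hr1 : (0 : ℝ) < (r : ℝ) - 1 := sub_pos.2 (by exact_mod_cast (by omega : 1 < r))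
  have hC : 0 < DiestelLeader.C₁ q := by
    have := DiestelLeader.log_natCast_pos hq
    rw [DiestelLeader.C₁_eq hq]
    positivity
  have hρ : 0 < DiestelLeader.rhoDL q r := by
    unfold DiestelLeader.rhoDL
    positivity
  refine ⟨fun hqr => ?_, ?_⟩
  · have hrq : (0 : ℝ) < r - q := sub_pos.2 (by exact_mod_cast hqr)
    have hlim := DiestelLeader.tendsto_normalized hq hqr.le 3
      (DiestelLeader.tendsto_dlCoeff_of_lt hq hqr) hsum
    have hL : 0 < 4 * Real.pi ^ 2 * ((q : ℝ) * r * (q + r) * (q - 1) * (r - 1)) /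
        ((r : ℝ) - q) ^ 3 * √(2 * Real.pi / DiestelLeader.C₁ q) := by positivity
    obtain ⟨P, hP, hPρ⟩ := DiestelLeader.exists_dlOperator H₁ H₂ hq hr
    have hrad : (spectralRadius ℂ P).toReal = DiestelLeader.rhoDL q r :=
      hP.spectralRadius_eq hPρ (DiestelLeader.DLRoot T₁ T₂ ω₁ ω₂ o₁ o₂)
        (DiestelLeader.eventually_pow_le_of_tendsto_normalized hρ hξ hL hlim)
    refine ⟨P, hP, hrad, ?_⟩
    rw [hrad]
    refine (DiestelLeader.isEquivalent_of_tendsto_normalized hρ hξ hL.ne' hlim).congr_right ?_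
    filter_upwards [DiestelLeader.tendsto_sixthRoot.eventually_gt_atTop 0] with N hN
    have e : (N : ℝ) ^ (-(5 : ℝ) / 6) =
        DiestelLeader.sixthRoot N / DiestelLeader.sixthRoot N ^ (2 * 3) := by
      have : (N : ℝ) ^ (-(5 : ℝ) / 6) = (DiestelLeader.sixthRoot N ^ 5)⁻¹ := by
        rw [DiestelLeader.sixthRoot, ← Real.rpow_natCast, ← Real.rpow_mul N.cast_nonneg,
          ← Real.rpow_neg N.cast_nonneg]
        norm_num
      rw [this]
      field_simp
    rw [e, ← DiestelLeader.sixthRoot_sq, DiestelLeader.B₁_eq hq, DiestelLeader.A₁]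
    ring
  · rintro rfl
    have hlim := DiestelLeader.tendsto_normalized hq le_rfl 0
      (DiestelLeader.tendsto_dlCoeff_self hq) hsum
    have hL : 2 * ((r : ℝ) - 1) ^ 2 * √(2 * Real.pi / DiestelLeader.C₁ r) ≠ 0 := by positivity
    have h1 : DiestelLeader.rhoDL r r = 1 := by
      rw [DiestelLeader.rhoDL, Real.sqrt_mul_self hr0.le]
      field_simp
      norm_num
    refine (DiestelLeader.isEquivalent_of_tendsto_normalized hρ hξ hL hlim).congr_right ?_
    refine Filter.Eventually.of_forall fun N => ?_
    simp only [h1, one_pow, mul_one, pow_zero, inv_one, mul_zero, div_one]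
    rw [← DiestelLeader.sixthRoot_sq, DiestelLeader.B₁_eq hq, DiestelLeader.Abar₁,
      DiestelLeader.sixthRoot]
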